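/- Let $a_0>0$ and let $g:\mathbf R^2\to\mathbf R$ satisfy $(x'-x)/a_0\le g(x',y)-g(x,y)\le a_0(x'-x)$ for all $x<x'$ and all $y$, and $|g(x,y)-g(x,y')|\le 10^{-2}|y-y'|$ for all $x,y,y'$. Let $(x,y)\mapsto(P(x,y),y)$ be the inverse of $(x,y)\mapsto(g(x,y),y)$, and let $u:\mathbf R\to\mathbf R$ be measurable with $\|u\|_\infty\le 1/10$. For a rectangle $R\subset\mathbf R^2$ with length $l(R)\ge w(R)$ (its width) and with long sides of slope $\mathrm{slope}(R)\in\mathbf R$, let $EX(R)$ be the closed interval of length $w(R)/l(R)$ centred at $\mathrm{slope}(R)$, and let $$\mathrm{pop}_R=\frac{|\{z\in R:\ u(P(z))\in EX(R)\}|}{|R|}.$$ For a constant $C\geq 1$ write $R_1\le R_2$ if $R_1\subset CR_2$ and $EX(R_2)\subset EX(R_1)$, where $CR_2$ is the concentric dilate of $R_2$ by the factor $C$. There is an absolute constant $C_0\ge 1$, and for each $p\in(1,\infty)$ a constant $A=A(p,a_0)$ depending only on $p$ and $a_0$, such that the following hold for all $g,u$ as above. (1) Let $C\ge C_0$, $\omega,\delta,\lambda>0$,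 let $F\subset\mathbf R^2$ be measurable, and let $\mathcal R_0$ be a collection of rectangles of width $\omega$ that are pairwise incomparable under $\le$ and whose uncertainty intervals form a grid: for $R,R'\in\mathcal R_0$ the intervals $EX(R)$, $EX(R')$ are nested or have disjoint interiors (as is the case when they are dyadic intervals). If $\mathrm{pop}_R\ge\delta$ and $|F\cap R|\ge\lambda|R|$ for every $R\in\mathcal R_0$, then $$\sum_{R\in\mathcal R_0}|R|\le A\,\frac{|F|}{\delta\lambda^p}.$$ (2) For $\omega,\delta>0$ let $\mathcal R_{\delta,\omega}$ be the set of all rectangles $R$ with $\mathrm{slope}(R)\in[-1,1]$, $\mathrm{pop}_R\ge\delta$ and $w(R)=\omega$, and let $$M_{\mathcal R_{\delta,\omega}}f(z)=\sup_{z\in R\in\mathcal R_{\delta,\omega}}\frac1{|R|}\int_R|f|$$ (with value $0$ if there is no such $R$). Then $\|M_{\mathcal R_{\delta,\omega}}f\|_{L^p}\le \dfrac{A}{\delta}\,\|f\|_{L^p}$ for all $f\in L^p(\mathbf R^2)$. -/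

import Mathlib

open MeasureTheory Set

noncomputable section

namespace LipKakeya

/-- `(x, y) ↦ (g x y, y)` is a bi-Lipschitz horizontal distortion of the plane with constant `a₀`,
mapping vertical lines to curves that are Lipschitz over the `y`-axis with constant `b₀`. -/
structure IsDistortion (a₀ b₀ : ℝ) (g : ℝ → ℝ → ℝ) : Prop where
  lower : ∀ x x' y : ℝ, x < x' → (x' - x) / a₀ ≤ g x' y - g x y
  upper : ∀ x x' y : ℝ, x < x' → g x' y - g x y ≤ a₀ * (x' - x)
  vert : ∀ x y y' : ℝ, |g x y - g x y'| ≤ b₀ * |y' - y|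

/-- The first component `P` of the inverse `(x, y) ↦ (P (x, y), y)` of `(x, y) ↦ (g x y, y)`. -/
def proj (g : ℝ → ℝ → ℝ) (z : ℝ × ℝ) : ℝ :=
  Function.invFun (fun s => g s z.2) z.1

theorem IsDistortion.injective {a₀ b₀ : ℝ} {g : ℝ → ℝ → ℝ} (ha : 0 < a₀)
    (hg : IsDistortion a₀ b₀ g) (y : ℝ) : Function.Injective (fun s => g s y) := by
  have h : StrictMono (fun s => g s y) := fun x x' hx => by
    have h1 := hg.lower x x' y hx
    have h2 : 0 < (x' - x) / a₀ := div_pos (sub_pos.2 hx) ha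
    show g x y < g x' y
    linarith
  exact h.injective

theorem IsDistortion.proj_apply {a₀ b₀ : ℝ} {g : ℝ → ℝ → ℝ} (ha : 0 < a₀)
    (hg : IsDistortion a₀ b₀ g) (x y : ℝ) : proj g (g x y, y) = x :=
  Function.leftInverse_invFun (hg.injective ha y) x

/-- A (nondegenerate) rectangle in the plane, given by its centre, the slope of its long sides,
its length (the long side) and its width (the short side). -/
@[ext] structure Rect where
  center : ℝ × ℝ
  slope : ℝ
  len : ℝ
  wid : ℝ
  wid_pos : 0 < wid
  wid_le_len : wid ≤ len

namespace Rect

/-- The points of `C R`: same centre and directions, both side lengths multiplied by `C`.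
The long sides are parallel to `(1, slope)`. -/
def dilate (R : Rect) (C : ℝ) : Set (ℝ × ℝ) :=
  {z | |(z.1 - R.center.1) + R.slope * (z.2 - R.center.2)|
          < √(1 + R.slope ^ 2) * (C * R.len / 2) ∧
       |(z.2 - R.center.2) - R.slope * (z.1 - R.center.1)|
          < √(1 + R.slope ^ 2) * (C * R.wid / 2)}

/-- The points of the rectangle. -/
def carrier (R : Rect) : Set (ℝ × ℝ) := R.dilate 1

/-- The uncertainty interval: length `wid / len`, centred at the slope. -/
def EX (R : Rect) : Set ℝ :=
  Icc (R.slope - R.wid / R.len / 2) (R.slope + R.wid / R.len / 2)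

/-- The popularity of `R` for the field `u ∘ P`. -/
def pop (u : ℝ → ℝ) (g : ℝ → ℝ → ℝ) (R : Rect) : ENNReal :=
  volume ((fun z => u (proj g z)) ⁻¹' R.EX ∩ R.carrier) / volume R.carrier

/-- `R₁ ≤ R₂`, with dilation constant `C`. -/
def Below (C : ℝ) (R₁ R₂ : Rect) : Prop :=
  R₁.carrier ⊆ R₂.dilate C ∧ R₂.EX ⊆ R₁.EX

end Rect

/-- The rectangles of width `ω`, slope in `[-1, 1]` and popularity at least `δ`. -/
def popularRects (u : ℝ → ℝ) (g : ℝ → ℝ → ℝ) (δ ω : ℝ) : Set Rect :=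
  {R | R.slope ∈ Icc (-1 : ℝ) 1 ∧ ENNReal.ofReal δ ≤ R.pop u g ∧ R.wid = ω}

/-- The Lipschitz-Kakeya maximal function. -/
def kakeyaMax (u : ℝ → ℝ) (g : ℝ → ℝ → ℝ) (δ ω : ℝ) (f : ℝ × ℝ → ℝ) (z : ℝ × ℝ) : ENNReal :=
  ⨆ R ∈ {R : Rect | R ∈ popularRects u g δ ω ∧ z ∈ R.carrier},
    (∫⁻ x in R.carrier, ‖f x‖ₑ) / volume R.carrier

end LipKakeya

end

noncomputable section

namespace LipKakeya

/-! ### The projection `P` and its growth along lines. -/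

section Distortion

variable {a₀ b₀ : ℝ} {g : ℝ → ℝ → ℝ}

/-! The heart is a moment bound for the counting function N = ∑ 1_R of a finite family of popular
rectangles of equal width, whose uncertainty intervals form a grid and in which nested intervals
force disjoint rectangles: ∫ N^(m+2) ≤ c δ^(-(m+1)) ∑ |R| (`Admissible.lintegral_sum_pow_le`).
Incomparable families qualify: of two intersecting rectangles with nested intervals, the shorter
lies in the 5-fold dilate of the longer (`Rect.carrier_subset_dilate`).

Expanding the power by length (`sum_pow_succ_le`), it suffices to integrate over one rectangle R₁ a
power of the count of the rectangles that are no longer. The field depends only on P, which grows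
linearly along lines of slope at most 1, so integrals of functions of P over R₁ are one-dimensional
integrals times the width. A popular R projects into a base interval of length comparable to l(R),
in which {u ∈ EX(R)} has density at least a multiple of δ. A greedy selection, longest first, makes
the base intervals of selected rectangles with nested EX disjoint; as u has one value at each point,
the sets {u ∈ EX(R)} inside these intervals overlap at most twice. Rectangles of the family through
a given point have EX with disjoint interiors, so they inject into the selected rectangles whose
enlarged base intervals contain P of the point. Thus N is dominated on R₁ by a count of intervals
satisfying a Carleson packing condition, which has all moments, each power costing 1/δ
(`lintegral_sum_ball_pow_le`).

Duality between m+2 and 1+1/(m+1) gives the covering lemma with a single factor 1/δ. For the maximal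
function, each rectangle is put in a comparable one with dyadic EX; selection and covering give a
weak type bound, which is interpolated with the trivial bound at infinity. -/

theorem IsDistortion.surjective (ha : 0 < a₀) (hg : IsDistortion a₀ b₀ g) (y : ℝ) :
    Function.Surjective (fun s => g s y) := by
  have hlip : ∀ s t, |g s y - g t y| ≤ a₀ * |s - t| := by
    have key : ∀ s t, s < t → |g t y - g s y| ≤ a₀ * |t - s| := fun s t h => by
      have h1 := hg.lower s t y h
      have h2 := hg.upper s t y h
      have h3 : 0 < (t - s) / a₀ := div_pos (sub_pos.2 h) ha
      rw [abs_of_pos (by linarith), abs_of_pos (sub_pos.2 h)]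
      exact h2
    intro s t
    rcases lt_trichotomy s t with h | h | h
    · rw [abs_sub_comm, abs_sub_comm s]
      exact key s t h
    · simp [h]
    · exact key t s h
  have hcont : Continuous (fun s => g s y) := by
    have : LipschitzWith ⟨a₀, ha.le⟩ (fun s => g s y) :=
      LipschitzWith.of_dist_le_mul fun s t => by
        rw [Real.dist_eq, Real.dist_eq]; exact hlip s t
    exact this.continuous
  intro x
  -- A move by `d` from 0 changes `g` by at least `|x - g 0 y| + 1`, enough to pass `x` on either
  -- side.
  set d := a₀ * (|x - g 0 y| + 1) with hd
  have hdpos : 0 < d := by positivity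
  have hda : d / a₀ = |x - g 0 y| + 1 := by rw [hd]; field_simp
  have h1 := hg.lower 0 d y hdpos
  have h2 := hg.lower (-d) 0 y (by linarith)
  simp only [sub_zero, zero_sub, neg_neg] at h1 h2
  have h3 := le_abs_self (x - g 0 y)
  have h4 := neg_abs_le (x - g 0 y)
  obtain ⟨s, -, hs⟩ := intermediate_value_Icc (show -d ≤ d by linarith) hcont.continuousOn
    (show x ∈ Icc (g (-d) y) (g d y) from ⟨by linarith, by linarith⟩)
  exact ⟨s, hs⟩

theorem IsDistortion.apply_proj (ha : 0 < a₀) (hg : IsDistortion a₀ b₀ g) (z : ℝ × ℝ) :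
    g (proj g z) z.2 = z.1 :=
  Function.rightInverse_invFun (hg.surjective ha z.2) z.1

theorem IsDistortion.abs_proj_sub_le (ha : 0 < a₀) (hg : IsDistortion a₀ b₀ g)
    (z z' : ℝ × ℝ) :
    |proj g z - proj g z'| ≤ a₀ * (|z.1 - z'.1| + b₀ * |z.2 - z'.2|) := by
  have key : ∀ z z' : ℝ × ℝ, proj g z' < proj g z →
      proj g z - proj g z' ≤ a₀ * (|z.1 - z'.1| + b₀ * |z.2 - z'.2|) := fun z z' h => by
    have h1 := hg.lower _ _ z.2 h
    have h2 := hg.vert (proj g z') z'.2 z.2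
    rw [hg.apply_proj ha] at h1 h2
    have h3 := le_abs_self (z.1 - z'.1)
    have h4 := le_abs_self (z'.1 - g (proj g z') z.2)
    rw [div_le_iff₀ ha] at h1
    nlinarith
  rcases lt_trichotomy (proj g z) (proj g z') with h | h | h
  · have := key z' z h
    rw [abs_sub_comm, abs_of_pos (sub_pos.2 h), abs_sub_comm z.1, abs_sub_comm z.2]
    exact this
  · rw [h, sub_self, abs_zero]
    have h1 := (abs_nonneg _).trans (hg.vert 0 z'.2 z.2)
    positivity
  · rw [abs_of_pos (sub_pos.2 h)]
    exact key z z' h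

theorem IsDistortion.continuous_proj (ha : 0 < a₀) (hb : 0 ≤ b₀) (hg : IsDistortion a₀ b₀ g) :
    Continuous (proj g) := by
  have hK : 0 ≤ a₀ * (1 + b₀) := by positivity
  refine (LipschitzWith.of_dist_le_mul (K := ⟨a₀ * (1 + b₀), hK⟩) fun z z' => ?_).continuous
  rw [Real.dist_eq]
  refine (hg.abs_proj_sub_le ha z z').trans ?_
  have h1 : |z.1 - z'.1| ≤ dist z z' := by rw [← Real.dist_eq]; exact le_max_left _ _
  have h2 : |z.2 - z'.2| ≤ dist z z' := by rw [← Real.dist_eq]; exact le_max_right _ _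
  change _ ≤ a₀ * (1 + b₀) * dist z z'
  have := mul_le_mul_of_nonneg_left h2 hb
  nlinarith

/-- `P` grows at a linear rate along lines of slope at most one. -/
theorem IsDistortion.sub_le_proj_sub (ha : 0 < a₀) (hb : 0 ≤ b₀) (hb' : b₀ ≤ 1 / 2)
    (hg : IsDistortion a₀ b₀ g)
    {σ : ℝ} (hσ : |σ| ≤ 1) (b : ℝ) {x x' : ℝ} (hx : x < x') :
    x' - x ≤ 2 * a₀ * (proj g (x', σ * x' + b) - proj g (x, σ * x + b)) := by
  set s := proj g (x, σ * x + b)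
  set s' := proj g (x', σ * x' + b)
  have h1 : g s (σ * x + b) = x := hg.apply_proj ha (x, σ * x + b)
  have h2 : g s' (σ * x' + b) = x' := hg.apply_proj ha (x', σ * x' + b)
  have h3 := hg.vert s (σ * x' + b) (σ * x + b)
  have h4 : |σ * x + b - (σ * x' + b)| ≤ x' - x := by
    rw [show σ * x + b - (σ * x' + b) = -(σ * (x' - x)) by ring, abs_neg, abs_mul,
      abs_of_pos (sub_pos.2 hx)]
    nlinarith
  have h5 := le_abs_self (g s (σ * x' + b) - g s (σ * x + b))
  have h6 := mul_le_mul_of_nonneg_left h4 hb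
  -- The part of `x' - x` due to the vertical motion is at most `b₀ * (x' - x)`, hence at most half
  -- of it, and is absorbed. This also excludes `s' ≤ s`.
  rcases lt_trichotomy s s' with h | h | h
  · have := hg.upper s s' (σ * x' + b) h
    nlinarith
  · rw [← h] at h2
    nlinarith
  · have := hg.lower s' s (σ * x' + b) h
    have h7 : 0 < (s - s') / a₀ := div_pos (sub_pos.2 h) ha
    nlinarith

end Distortion

/-- `φ` is antilipschitz, which controls the one-dimensional Hausdorff measure of preimages; no
differentiability is needed. -/
theorem volume_preimage_le_of_sub_le {φ : ℝ → ℝ} {K : ℝ} (hK : 0 < K)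
    (h : ∀ x x', x < x' → x' - x ≤ K * (φ x' - φ x)) (s : Set ℝ) :
    volume (φ ⁻¹' s) ≤ ENNReal.ofReal K * volume s := by
  have ha : AntilipschitzWith ⟨K, hK.le⟩ φ := by
    refine AntilipschitzWith.of_le_mul_dist fun x x' => ?_
    change dist x x' ≤ K * dist (φ x) (φ x')
    rcases lt_trichotomy x x' with hx | hx | hx
    · rw [dist_comm, Real.dist_eq, abs_of_pos (sub_pos.2 hx), dist_comm, Real.dist_eq]
      exact (h _ _ hx).trans (mul_le_mul_of_nonneg_left (le_abs_self _) hK.le)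
    · simp [hx]
    · rw [Real.dist_eq, abs_of_pos (sub_pos.2 hx), Real.dist_eq]
      exact (h _ _ hx).trans (mul_le_mul_of_nonneg_left (le_abs_self _) hK.le)
  have := ha.hausdorffMeasure_preimage_le (d := 1) zero_le_one s
  rw [← hausdorffMeasure_real]
  refine this.trans (le_of_eq ?_)
  rw [ENNReal.rpow_one, ENNReal.ofReal, Real.toNNReal_of_nonneg hK.le]
  rfl

theorem lintegral_comp_le_of_sub_le {φ : ℝ → ℝ} (hφ : Measurable φ) {K : ℝ} (hK : 0 < K)
    (h : ∀ x x', x < x' → x' - x ≤ K * (φ x' - φ x)) {f : ℝ → ENNReal} (hf : Measurable f) :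
    ∫⁻ x, f (φ x) ≤ ENNReal.ofReal K * ∫⁻ s, f s := by
  rw [← lintegral_map hf hφ, ← smul_eq_mul, ← lintegral_smul_measure]
  refine lintegral_mono' (Measure.le_iff.2 fun s hs => ?_) le_rfl
  rw [Measure.map_apply hφ hs]
  simpa using volume_preimage_le_of_sub_le hK h s

theorem lintegral_eq_lintegral_shear (σ : ℝ) {f : ℝ × ℝ → ENNReal} (hf : Measurable f) :
    ∫⁻ z, f z = ∫⁻ b, ∫⁻ x, f (x, σ * x + b) := by
  rw [Measure.volume_eq_prod, lintegral_prod _ hf.aemeasurable]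
  refine Eq.trans ?_ (lintegral_lintegral_swap (f := fun x b => f (x, σ * x + b))
    (by fun_prop))
  refine lintegral_congr fun x => ?_
  exact (lintegral_add_left_eq_self (μ := volume) (fun y => f (x, y)) (σ * x)).symm

/-! ### Plane geometry of rectangles and uncertainty intervals. -/

namespace Rect

theorem len_pos (R : Rect) : 0 < R.len := R.wid_pos.trans_le R.wid_le_len

theorem isOpen_dilate (R : Rect) (C : ℝ) : IsOpen (R.dilate C) := by
  have h1 : Continuous fun z : ℝ × ℝ =>
      |(z.1 - R.center.1) + R.slope * (z.2 - R.center.2)| := by fun_prop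
  have h2 : Continuous fun z : ℝ × ℝ =>
      |(z.2 - R.center.2) - R.slope * (z.1 - R.center.1)| := by fun_prop
  exact (isOpen_lt h1 continuous_const).inter (isOpen_lt h2 continuous_const)

theorem isOpen_carrier (R : Rect) : IsOpen R.carrier := R.isOpen_dilate 1

theorem dilate_mono (R : Rect) {C D : ℝ} (h : C ≤ D) : R.dilate C ⊆ R.dilate D := by
  rintro z ⟨h1, h2⟩
  have hq : 0 ≤ √(1 + R.slope ^ 2) := Real.sqrt_nonneg _
  have hl := R.len_pos
  have hw := R.wid_pos
  refine ⟨h1.trans_le ?_, h2.trans_le ?_⟩ <;> gcongr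

/-- On lines along the long sides, the offset `b` fills an interval of length `q * C * wid` and each
line is met in length `C * len / q`; the factors `q` cancel. -/
theorem volume_dilate (R : Rect) {C : ℝ} (hC : 0 < C) :
    volume (R.dilate C) = ENNReal.ofReal (C ^ 2 * (R.len * R.wid)) := by
  have hl := R.len_pos
  have hw := R.wid_pos
  set σ := R.slope with hσ
  set q := √(1 + σ ^ 2) with hq
  have hq2 : q ^ 2 = 1 + σ ^ 2 := Real.sq_sqrt (by positivity)
  have hqpos : 0 < q := Real.sqrt_pos.2 (by positivity)
  have hmeas := (R.isOpen_dilate C).measurableSet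
  rw [← lintegral_indicator_one hmeas, lintegral_eq_lintegral_shear σ
    (measurable_one.indicator hmeas)]
  have hcalc : ∀ b, ∫⁻ x, (R.dilate C).indicator (1 : ℝ × ℝ → ENNReal) (x, σ * x + b)
      = (Metric.ball (R.center.2 - σ * R.center.1) (q * (C * R.wid / 2))).indicator
          (fun _ => ENNReal.ofReal (C * R.len / q)) b := by
    intro b
    by_cases hb : b ∈ Metric.ball (R.center.2 - σ * R.center.1) (q * (C * R.wid / 2))
    · rw [indicator_of_mem hb]
      have : (fun x => (R.dilate C).indicator (1 : ℝ × ℝ → ENNReal) (x, σ * x + b))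
          = (Metric.ball (R.center.1 - σ * (b - (R.center.2 - σ * R.center.1)) / q ^ 2)
              (C * R.len / 2 / q)).indicator 1 := by
        ext x
        have : (x, σ * x + b) ∈ R.dilate C ↔ x ∈ Metric.ball
            (R.center.1 - σ * (b - (R.center.2 - σ * R.center.1)) / q ^ 2)
              (C * R.len / 2 / q) := by
          rw [Metric.mem_ball, Real.dist_eq] at hb ⊢
          simp only [dilate, mem_ofPred_eq, ← hσ, ← hq]
          rw [and_iff_left (by convert hb using 2; ring),
            show x - R.center.1 + σ * (σ * x + b - R.center.2) = q ^ 2 *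
              (x - (R.center.1 - σ * (b - (R.center.2 - σ * R.center.1)) / q ^ 2)) by
              field_simp; rw [hq2]; ring, abs_mul, abs_of_pos (by positivity : 0 < q ^ 2),
            lt_div_iff₀ hqpos]
          constructor <;> intro h <;> nlinarith
        by_cases hx : (x, σ * x + b) ∈ R.dilate C
        · rw [indicator_of_mem hx, indicator_of_mem (this.1 hx)]; rfl
        · rw [indicator_of_notMem hx, indicator_of_notMem (fun h => hx (this.2 h))]
      rw [this, lintegral_indicator_one Metric.isOpen_ball.measurableSet, Real.volume_ball]
      congr 1
      ring
    · rw [indicator_of_notMem hb]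
      have : ∀ x, (x, σ * x + b) ∉ R.dilate C := fun x hx => hb <| by
        have := hx.2
        rw [Metric.mem_ball, Real.dist_eq]
        convert this using 2
        simp only [← hσ]
        ring
      simp [this]
  simp_rw [hcalc]
  rw [lintegral_indicator_const Metric.isOpen_ball.measurableSet, Real.volume_ball,
    ← ENNReal.ofReal_mul (by positivity)]
  congr 1
  field_simp

theorem volume_carrier (R : Rect) : volume R.carrier = ENNReal.ofReal (R.len * R.wid) := by
  rw [carrier, R.volume_dilate one_pos, one_pow, one_mul]

theorem volume_carrier_ne_zero (R : Rect) : volume R.carrier ≠ 0 := by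
  rw [volume_carrier]
  simpa using mul_pos R.len_pos R.wid_pos

theorem volume_carrier_ne_top (R : Rect) : volume R.carrier ≠ ⊤ := by
  rw [volume_carrier]
  exact ENNReal.ofReal_ne_top

theorem center_mem (R : Rect) : R.center ∈ R.carrier := by
  have hl := R.len_pos
  have hw := R.wid_pos
  have hq : 0 < √(1 + R.slope ^ 2) := Real.sqrt_pos.2 (by positivity)
  constructor <;> simp <;> positivity

theorem slope_mem_EX (R : Rect) : R.slope ∈ R.EX := by
  have : 0 < R.wid / R.len / 2 := half_pos (div_pos R.wid_pos R.len_pos)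
  constructor <;> linarith

theorem EX_subset_iff {R R' : Rect} : R'.EX ⊆ R.EX ↔
    R.slope - R.wid / R.len / 2 ≤ R'.slope - R'.wid / R'.len / 2 ∧
      R'.slope + R'.wid / R'.len / 2 ≤ R.slope + R.wid / R.len / 2 := by
  have : 0 < R'.wid / R'.len / 2 := half_pos (div_pos R'.wid_pos R'.len_pos)
  exact Icc_subset_Icc_iff (by linarith)

theorem len_le_len_of_EX_subset {R R' : Rect} (hw : R.wid = R'.wid) (h : R'.EX ⊆ R.EX) :
    R.len ≤ R'.len := by
  obtain ⟨h1, h2⟩ := EX_subset_iff.1 h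
  have h3 : R'.wid / R'.len ≤ R'.wid / R.len := by rw [← hw] at *; linarith
  exact (div_le_div_iff_of_pos_left R'.wid_pos R'.len_pos R.len_pos).1 h3

theorem EX_subset_of_len_le {R R' : Rect} (hw : R.wid = R'.wid) (h : R'.EX ⊆ R.EX)
    (hl : R'.len ≤ R.len) : R.EX ⊆ R'.EX := by
  have hl' : R.len = R'.len := le_antisymm (len_le_len_of_EX_subset hw h) hl
  obtain ⟨h1, h2⟩ := EX_subset_iff.1 h
  rw [EX_subset_iff]
  rw [hw, hl'] at *
  constructor <;> linarith

/-- A short rectangle with the wider uncertainty interval lies in a dilate of any longer rectangle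
that it meets. -/
theorem carrier_subset_dilate {R R' : Rect} (hw : R.wid = R'.wid) (h : R'.EX ⊆ R.EX)
    (hne : (R.carrier ∩ R'.carrier).Nonempty) : R.carrier ⊆ R'.dilate 5 := by
  obtain ⟨z, hz, hz'⟩ := hne
  intro y hy
  have hlen := len_le_len_of_EX_subset hw h
  have hs := h R'.slope_mem_EX
  have hl := R.len_pos
  have hwl := R.wid_le_len
  have hw0 := R.wid_pos
  obtain ⟨hz1, hz2⟩ := hz
  obtain ⟨hz1', hz2'⟩ := hz'
  obtain ⟨hy1, hy2⟩ := hy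
  rw [← hw] at hz2'
  set σ := R.slope
  set τ := R'.slope
  set p := √(1 + σ ^ 2) with hp
  set q := √(1 + τ ^ 2) with hq
  have hp2 : p ^ 2 = 1 + σ ^ 2 := Real.sq_sqrt (by positivity)
  have hq2 : q ^ 2 = 1 + τ ^ 2 := Real.sq_sqrt (by positivity)
  have hp1 : 1 ≤ p := Real.one_le_sqrt.2 (by nlinarith [sq_nonneg σ])
  have hq1 : 1 ≤ q := Real.one_le_sqrt.2 (by nlinarith [sq_nonneg τ])
  -- Since `τ` lies in `R.EX`, over the length of `R` the two directions drift apart by at most half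
  -- the width.
  have hd : |τ - σ| ≤ R.wid / R.len / 2 := abs_le.2 ⟨by linarith [hs.1], by linarith [hs.2]⟩
  have hd' : |τ - σ| * R.len ≤ R.wid / 2 := by
    calc |τ - σ| * R.len ≤ R.wid / R.len / 2 * R.len := by gcongr
      _ = R.wid / 2 := by field_simp
  -- `1 + σ * τ` and `τ - σ` are `p * q` times the cosine and sine of the angle from `R` to `R'`.
  have hcos : |1 + σ * τ| ≤ p * q := by
    refine abs_le_of_sq_le_sq ?_ (by positivity)
    rw [mul_pow, hp2, hq2]
    nlinarith [sq_nonneg (σ - τ)]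
  have hsin : |τ - σ| ≤ p * q * |τ - σ| := by
    have : 1 ≤ p * q := by nlinarith
    nlinarith [abs_nonneg (τ - σ)]
  -- coordinates of `y - z` in the frame of `R`
  set α := (y.1 - z.1) + σ * (y.2 - z.2) with hα
  set β := (y.2 - z.2) - σ * (y.1 - z.1) with hβ
  have hαle : |α| ≤ p * R.len := by
    have : α = ((y.1 - R.center.1) + σ * (y.2 - R.center.2))
        - ((z.1 - R.center.1) + σ * (z.2 - R.center.2)) := by rw [hα]; ring
    rw [this]
    refine (abs_sub _ _).trans ?_
    linarith
  have hβle : |β| ≤ p * R.wid := by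
    have : β = ((y.2 - R.center.2) - σ * (y.1 - R.center.1))
        - ((z.2 - R.center.2) - σ * (z.1 - R.center.1)) := by rw [hβ]; ring
    rw [this]
    refine (abs_sub _ _).trans ?_
    linarith
  have hdw : |τ - σ| ≤ 1 / 2 := by
    have : R.wid / R.len ≤ 1 := (div_le_one hl).2 hwl
    linarith
  have e1 : (y.1 - R'.center.1) + τ * (y.2 - R'.center.2)
      = ((z.1 - R'.center.1) + τ * (z.2 - R'.center.2))
        + ((1 + σ * τ) * α + (τ - σ) * β) / p ^ 2 := by
    rw [hα, hβ, hp2]; field_simp; ring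
  have e2 : (y.2 - R'.center.2) - τ * (y.1 - R'.center.1)
      = ((z.2 - R'.center.2) - τ * (z.1 - R'.center.1))
        + ((1 + σ * τ) * β - (τ - σ) * α) / p ^ 2 := by
    rw [hα, hβ, hp2]; field_simp; ring
  have hp2pos : 0 < p ^ 2 := by positivity
  have b1 : |((1 + σ * τ) * α + (τ - σ) * β) / p ^ 2| ≤ q * (2 * R.len) := by
    rw [abs_div, abs_of_pos hp2pos, div_le_iff₀ hp2pos]
    calc |(1 + σ * τ) * α + (τ - σ) * β|
        ≤ |1 + σ * τ| * |α| + |τ - σ| * |β| := by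
          rw [← abs_mul, ← abs_mul]; exact abs_add_le _ _
      _ ≤ (p * q) * (p * R.len) + (p * q * (1 / 2)) * (p * R.wid) := by
          gcongr
          exact hsin.trans (by gcongr)
      _ ≤ q * (2 * R.len) * p ^ 2 := by
          have : 0 ≤ q * p ^ 2 := by positivity
          nlinarith
  have b2 : |((1 + σ * τ) * β - (τ - σ) * α) / p ^ 2| ≤ q * (3 / 2 * R.wid) := by
    rw [abs_div, abs_of_pos hp2pos, div_le_iff₀ hp2pos]
    calc |(1 + σ * τ) * β - (τ - σ) * α|
        ≤ |1 + σ * τ| * |β| + |τ - σ| * |α| := by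
          rw [← abs_mul, ← abs_mul]; exact abs_sub _ _
      _ ≤ (p * q) * (p * R.wid) + (p * q * |τ - σ|) * (p * R.len) := by gcongr
      _ = p ^ 2 * q * (R.wid + |τ - σ| * R.len) := by ring
      _ ≤ p ^ 2 * q * (R.wid + R.wid / 2) := by gcongr
      _ = q * (3 / 2 * R.wid) * p ^ 2 := by ring
  have hqpos : 0 < q := by linarith
  -- In units of the sides the bounds are 1/2 + 2 along and 1/2 + 3/2 across; the first is the
  -- half-side 5/2 of the dilate.
  refine ⟨?_, ?_⟩
  · change |(y.1 - R'.center.1) + τ * (y.2 - R'.center.2)| < q * _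
    rw [e1]
    refine (abs_add_le _ _).trans_lt ?_
    have := mul_le_mul_of_nonneg_left hlen hqpos.le
    linarith
  · change |(y.2 - R'.center.2) - τ * (y.1 - R'.center.1)| < q * _
    rw [e2, ← hw]
    refine (abs_add_le _ _).trans_lt ?_
    linarith [mul_pos hqpos hw0]

theorem abs_sub_center_le {R : Rect} {z : ℝ × ℝ} (hz : z ∈ R.carrier) :
    |z.1 - R.center.1| ≤ R.len ∧ |z.2 - R.center.2| ≤ R.len := by
  obtain ⟨h1, h2⟩ := hz
  have hwl := R.wid_le_len
  have hl := R.len_pos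
  set σ := R.slope
  set q := √(1 + σ ^ 2) with hq
  have hq2 : q ^ 2 = 1 + σ ^ 2 := Real.sq_sqrt (by positivity)
  have hq1 : 1 ≤ q := Real.one_le_sqrt.2 (by nlinarith [sq_nonneg σ])
  have hσq : |σ| ≤ q := abs_le_of_sq_le_sq (by linarith) (by linarith)
  set α := z.1 - R.center.1 + σ * (z.2 - R.center.2) with hα
  set β := z.2 - R.center.2 - σ * (z.1 - R.center.1) with hβ
  have hα' : |α| ≤ q * (R.len / 2) := by linarith
  have hβ' : |β| ≤ q * (R.len / 2) := by
    refine h2.le.trans ?_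
    gcongr
    linarith
  have e1 : (z.1 - R.center.1) * q ^ 2 = α - σ * β := by rw [hα, hβ, hq2]; ring
  have e2 : (z.2 - R.center.2) * q ^ 2 = β + σ * α := by rw [hα, hβ, hq2]; ring
  have hq2pos : 0 < q ^ 2 := by positivity
  have key : ∀ s t : ℝ, |s| ≤ q * (R.len / 2) → |t| ≤ q * (R.len / 2) →
      |s| + |σ| * |t| ≤ R.len * q ^ 2 := fun s t hs ht => by
    calc |s| + |σ| * |t| ≤ q * (q * (R.len / 2)) + q * (q * (R.len / 2)) := by
          gcongr
          refine hs.trans ?_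
          have : 0 ≤ q * (R.len / 2) := by positivity
          nlinarith
      _ = R.len * q ^ 2 := by ring
  constructor
  · refine le_of_mul_le_mul_right ?_ hq2pos
    rw [← abs_of_pos hq2pos, ← abs_mul, abs_of_pos hq2pos, e1]
    refine (abs_sub _ _).trans ?_
    rw [abs_mul]
    exact key _ _ hα' hβ'
  · refine le_of_mul_le_mul_right ?_ hq2pos
    rw [← abs_of_pos hq2pos, ← abs_mul, abs_of_pos hq2pos, e2]
    refine (abs_add_le _ _).trans ?_
    rw [abs_mul]
    exact key _ _ hβ' hα'

end Rect

/-! ### Powers of sums, greedy selection, and moments of packed intervals. -/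

/-- When summands are added in increasing order of `r`, a new one `x` raises the power of the sum by
at most `(n + 1) * x * (x + y) ^ n`, and `x + y` involves only indices with no larger `r`. -/
theorem sum_pow_succ_le {ι : Type*} (s : Finset ι) (r : ι → ℝ) (a : ι → ENNReal) (n : ℕ) :
    (∑ i ∈ s, a i) ^ (n + 1)
      ≤ (n + 1) * ∑ i ∈ s, a i * (∑ j ∈ s with r j ≤ r i, a j) ^ n := by
  classical
  have key : ∀ (x y : ENNReal) (n : ℕ), (x + y) ^ (n + 1)
      ≤ y ^ (n + 1) + (n + 1) * (x * (x + y) ^ n) := by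
    intro x y n
    induction n with
    | zero => simp [add_comm]
    | succ n ih =>
      calc (x + y) ^ (n + 1 + 1) = (x + y) ^ (n + 1) * y + x * (x + y) ^ (n + 1) := by ring
        _ ≤ (y ^ (n + 1) + (n + 1) * (x * (x + y) ^ n)) * y + x * (x + y) ^ (n + 1) := by gcongr
        _ = y ^ (n + 1 + 1) + ((n + 1) * (x * ((x + y) ^ n * y)) + x * (x + y) ^ (n + 1)) := by
          ring
        _ ≤ y ^ (n + 1 + 1)
            + ((n + 1) * (x * ((x + y) ^ n * (x + y))) + x * (x + y) ^ (n + 1)) := by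
          gcongr
          exact le_add_self
        _ = y ^ (n + 1 + 1) + (((n + 1 : ℕ) : ENNReal) + 1) * (x * (x + y) ^ (n + 1)) := by
          push_cast; ring
  induction s using Finset.induction_on_max_value r with
  | empty => simp
  | insert i₀ s hi₀ hmax ih =>
    rw [Finset.sum_insert hi₀, Finset.sum_insert hi₀]
    have h1 : (insert i₀ s).filter (fun j => r j ≤ r i₀) = insert i₀ s := by
      refine Finset.filter_true_of_mem fun j hj => ?_
      rcases Finset.mem_insert.1 hj with rfl | hj
      · exact le_rfl
      · exact hmax j hj
    rw [h1, Finset.sum_insert hi₀]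
    refine (key _ _ n).trans ?_
    rw [mul_add, add_comm]
    gcongr
    refine ih.trans ?_
    gcongr with i hi
    exact Finset.subset_insert _ _

/-- Greedy selection, longest objects first. -/
theorem exists_selection {ι : Type*} (s : Finset ι) (L : ι → ℝ) (r : ι → ι → Prop)
    (hrefl : ∀ i ∈ s, r i i) (hL : ∀ i ∈ s, ∀ j ∈ s, r i j → L i ≤ L j)
    (hsymm : ∀ i ∈ s, ∀ j ∈ s, r i j → L j ≤ L i → r j i) :
    ∃ t ⊆ s, (∀ i ∈ s, ∃ j ∈ t, r i j) ∧ ∀ i ∈ t, ∀ j ∈ t, i ≠ j → ¬ r i j := by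
  classical
  induction s using Finset.strongInduction with
  | H s ih =>
    rcases s.eq_empty_or_nonempty with rfl | hs
    · exact ⟨∅, by simp⟩
    obtain ⟨i₀, hi₀, hmax⟩ := s.exists_max_image L hs
    have hsub : s.filter (fun i => ¬ r i i₀) ⊆ s := Finset.filter_subset _ _
    obtain ⟨t, hts, hcov, hsep⟩ := ih (s.filter fun i => ¬ r i i₀)
      (Finset.filter_ssubset.2 ⟨i₀, hi₀, not_not.2 (hrefl i₀ hi₀)⟩)
      (fun i hi => hrefl i (hsub hi)) (fun i hi j hj => hL i (hsub hi) j (hsub hj))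
      (fun i hi j hj => hsymm i (hsub hi) j (hsub hj))
    refine ⟨insert i₀ t, Finset.insert_subset hi₀ (hts.trans hsub), fun i hi => ?_, ?_⟩
    · by_cases h : r i i₀
      · exact ⟨i₀, Finset.mem_insert_self _ _, h⟩
      · obtain ⟨j, hj, hij⟩ := hcov i (Finset.mem_filter.2 ⟨hi, h⟩)
        exact ⟨j, Finset.mem_insert_of_mem hj, hij⟩
    · intro i hi j hj hij h
      rcases Finset.mem_insert.1 hi with hi' | hi'
      · subst hi'
        rcases Finset.mem_insert.1 hj with hj' | hj'
        · exact hij hj'.symm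
        · obtain ⟨hjs, hn⟩ := Finset.mem_filter.1 (hts hj')
          exact hn (hsymm _ hi₀ _ hjs h (hmax _ hjs))
      · rcases Finset.mem_insert.1 hj with hj' | hj'
        · subst hj'
          exact (Finset.mem_filter.1 (hts hi')).2 h
        · exact hsep i hi' j hj' hij h

/-- The sets `E i` overlap at most twice in an interval of length `2 * ρ`, so `η * ∑ r i ≤ 4 * ρ`.
The factor 3 anticipates the enlarged balls in the induction below. -/
theorem sum_ofReal_radius_le {ι : Type*} {η : ℝ} (hη : 0 < η) (x r : ι → ℝ) (E : ι → Set ℝ)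
    (hE : ∀ i, MeasurableSet (E i)) (s : Finset ι)
    (hsub : ∀ i ∈ s, E i ⊆ Metric.ball (x i) (r i))
    (hvol : ∀ i ∈ s, ENNReal.ofReal (η * r i) ≤ volume (E i))
    (hov : ∀ t, ∑ i ∈ s, (E i).indicator (1 : ℝ → ENNReal) t ≤ 2)
    {X ρ : ℝ} (hball : ∀ i ∈ s, Metric.ball (x i) (r i) ⊆ Metric.closedBall X ρ) :
    ∑ i ∈ s, ENNReal.ofReal (3 * r i) ≤ ENNReal.ofReal (12 / η) * ENNReal.ofReal ρ := by
  have h1 : ∑ i ∈ s, volume (E i) ≤ 2 * ENNReal.ofReal (2 * ρ) := by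
    calc ∑ i ∈ s, volume (E i) = ∫⁻ t, ∑ i ∈ s, (E i).indicator (1 : ℝ → ENNReal) t := by
          rw [lintegral_finsetSum _ fun i _ => measurable_one.indicator (hE i)]
          exact Finset.sum_congr rfl fun i _ => (lintegral_indicator_one (hE i)).symm
      _ ≤ ∫⁻ t, (Metric.closedBall X ρ).indicator (fun _ => 2) t := by
          refine lintegral_mono fun t => ?_
          by_cases ht : t ∈ Metric.closedBall X ρ
          · rw [indicator_of_mem ht]
            exact hov t
          · rw [indicator_of_notMem ht]
            refine le_of_eq (Finset.sum_eq_zero fun i hi => ?_)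
            exact indicator_of_notMem (fun h => ht (hball i hi (hsub i hi h))) _
      _ = 2 * ENNReal.ofReal (2 * ρ) := by
          rw [lintegral_indicator_const Metric.isClosed_closedBall.measurableSet,
            Real.volume_closedBall]
  have h2 : ∀ i ∈ s, ENNReal.ofReal (3 * r i)
      ≤ ENNReal.ofReal (3 / η) * volume (E i) := fun i hi => by
    refine le_trans (le_of_eq ?_) (mul_le_mul_right (hvol i hi) _)
    rw [← ENNReal.ofReal_mul (by positivity)]
    congr 1
    field_simp
  refine (Finset.sum_le_sum h2).trans ?_
  rw [← Finset.mul_sum]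
  refine (mul_le_mul_right h1 _).trans (le_of_eq ?_)
  rw [show (2 : ENNReal) = ENNReal.ofReal 2 by simp, ← ENNReal.ofReal_mul (by positivity),
    ← ENNReal.ofReal_mul (by positivity), ← ENNReal.ofReal_mul (by positivity)]
  congr 1
  ring

/-- The counting function of intervals that carry essentially disjoint sets of density `η`
has all its moments. -/
theorem lintegral_sum_ball_pow_le {ι : Type*} {η : ℝ} (hη : 0 < η) (x r : ι → ℝ) (E : ι → Set ℝ)
    (hE : ∀ i, MeasurableSet (E i)) (m : ℕ) (s : Finset ι)
    (hr : ∀ i ∈ s, 0 < r i) (hsub : ∀ i ∈ s, E i ⊆ Metric.ball (x i) (r i))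
    (hvol : ∀ i ∈ s, ENNReal.ofReal (η * r i) ≤ volume (E i))
    (hov : ∀ t, ∑ i ∈ s, (E i).indicator (1 : ℝ → ENNReal) t ≤ 2)
    {X ρ : ℝ} (hρ : 0 ≤ ρ) (hball : ∀ i ∈ s, Metric.ball (x i) (r i) ⊆ Metric.closedBall X ρ) :
    ∫⁻ t, (∑ i ∈ s, (Metric.ball (x i) (r i)).indicator (1 : ℝ → ENNReal) t) ^ (m + 1)
      ≤ ((m + 1).factorial : ENNReal) * ENNReal.ofReal (12 / η) ^ (m + 1) * ENNReal.ofReal ρ := by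
  classical
  have hmeas : ∀ i, Measurable ((Metric.ball (x i) (r i)).indicator (1 : ℝ → ENNReal)) :=
    fun i => measurable_one.indicator Metric.isOpen_ball.measurableSet
  induction m generalizing s X ρ with
  | zero =>
    have hsum := sum_ofReal_radius_le hη x r E hE s hsub hvol hov hball
    simp only [zero_add, pow_one, Nat.factorial_one, Nat.cast_one, one_mul]
    rw [lintegral_finsetSum _ fun i _ => hmeas i]
    refine le_trans (Finset.sum_le_sum fun i hi => ?_) hsum
    rw [lintegral_indicator_one Metric.isOpen_ball.measurableSet, Real.volume_ball]
    have := hr i hi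
    gcongr
    norm_num
  | succ m ih =>
    have hsum := sum_ofReal_radius_le hη x r E hE s hsub hvol hov hball
    set B := fun i => Metric.ball (x i) (r i)
    set C := ((m + 1).factorial : ENNReal) * ENNReal.ofReal (12 / η) ^ (m + 1)
    -- Balls that meet `B i` and are no larger lie in its concentric triple, so the inductive
    -- hypothesis applies to them with `ρ = 3 * r i`.
    have hstep : ∀ i ∈ s, ∫⁻ t, (B i).indicator (1 : ℝ → ENNReal) t
        * (∑ j ∈ s with r j ≤ r i, (B j).indicator (1 : ℝ → ENNReal) t) ^ (m + 1)
        ≤ C * ENNReal.ofReal (3 * r i) := by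
      intro i hi
      set s' := s.filter fun j => r j ≤ r i ∧ (B j ∩ B i).Nonempty
      have hs' : s' ⊆ s := Finset.filter_subset _ _
      have hri := hr i hi
      refine le_trans (lintegral_mono fun t => ?_) (ih s' (fun j hj => hr j (hs' hj))
        (fun j hj => hsub j (hs' hj)) (fun j hj => hvol j (hs' hj))
        (fun t => (Finset.sum_le_sum_of_subset hs').trans (hov t)) (X := x i) (by positivity) ?_)
      · by_cases ht : t ∈ B i
        · rw [indicator_of_mem ht, Pi.one_apply, one_mul]
          refine pow_le_pow_left₀ (zero_le) (le_of_eq ?_) _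
          symm
          refine Finset.sum_subset (fun j hj => ?_) (fun j hj hj' => ?_)
          · simp only [s', Finset.mem_filter] at hj ⊢
            exact ⟨hj.1, hj.2.1⟩
          · refine indicator_of_notMem (fun h => hj' ?_) _
            simp only [s', Finset.mem_filter] at hj ⊢
            exact ⟨hj.1, hj.2, t, h, ht⟩
        · rw [indicator_of_notMem ht, zero_mul]
          exact zero_le
      · intro j hj
        obtain ⟨hjs, hji, y, hy1, hy2⟩ := Finset.mem_filter.1 hj
        intro z hz
        simp only [B, Metric.mem_ball, Metric.mem_closedBall] at hy1 hy2 hz ⊢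
        have h1 := dist_triangle z (x j) (x i)
        have h2 := dist_triangle_left (x j) (x i) y
        linarith
    calc ∫⁻ t, (∑ i ∈ s, (B i).indicator (1 : ℝ → ENNReal) t) ^ (m + 1 + 1)
        ≤ ∫⁻ t, (m + 1 + 1 : ℕ) * ∑ i ∈ s, (B i).indicator (1 : ℝ → ENNReal) t
          * (∑ j ∈ s with r j ≤ r i, (B j).indicator (1 : ℝ → ENNReal) t) ^ (m + 1) := by
          refine lintegral_mono fun t => ?_
          exact_mod_cast sum_pow_succ_le s r (fun i => (B i).indicator (1 : ℝ → ENNReal) t) (m + 1)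
      _ = (m + 1 + 1 : ℕ) * ∑ i ∈ s, ∫⁻ t, (B i).indicator (1 : ℝ → ENNReal) t
          * (∑ j ∈ s with r j ≤ r i, (B j).indicator (1 : ℝ → ENNReal) t) ^ (m + 1) := by
          rw [lintegral_const_mul, lintegral_finsetSum]
          · intro i _
            exact (hmeas i).mul ((Finset.measurable_fun_sum _ fun j _ => hmeas j).pow_const _)
          · exact Finset.measurable_fun_sum _ fun i _ =>
              (hmeas i).mul ((Finset.measurable_fun_sum _ fun j _ => hmeas j).pow_const _)
      _ ≤ (m + 1 + 1 : ℕ) * (C * (ENNReal.ofReal (12 / η) * ENNReal.ofReal ρ)) := by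
          gcongr
          refine (Finset.sum_le_sum hstep).trans ?_
          rw [← Finset.mul_sum]
          gcongr
      _ = _ := by
          rw [Nat.factorial_succ (m + 1)]
          simp only [C]
          push_cast
          ring

/-! ### Popular rectangles seen on the base line. -/

section

variable {a₀ : ℝ} {g : ℝ → ℝ → ℝ} {u : ℝ → ℝ}

theorem IsDistortion.measurable_proj (ha : 0 < a₀) (hg : IsDistortion a₀ (1 / 100) g) :
    Measurable (proj g) :=
  (hg.continuous_proj ha (by norm_num)).measurable

theorem IsDistortion.lintegral_proj_line_le (ha : 0 < a₀) (hg : IsDistortion a₀ (1 / 100) g)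
    {σ : ℝ} (hσ : |σ| ≤ 1) (b : ℝ) {h : ℝ → ENNReal} (hh : Measurable h) :
    ∫⁻ x, h (proj g (x, σ * x + b)) ≤ ENNReal.ofReal (2 * a₀) * ∫⁻ s, h s := by
  refine lintegral_comp_le_of_sub_le (φ := fun x => proj g (x, σ * x + b))
    ((hg.measurable_proj ha).comp (by fun_prop)) (by positivity) (fun x x' hx => ?_) hh
  exact hg.sub_le_proj_sub ha (by norm_num) (by norm_num) hσ b hx

/-- Integrals over a rectangle of functions of `P` are one-dimensional integrals times the
width. -/
theorem IsDistortion.lintegral_carrier_comp_proj_le (ha : 0 < a₀)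
    (hg : IsDistortion a₀ (1 / 100) g) {R : Rect} (hσ : |R.slope| ≤ 1) {h : ℝ → ENNReal}
    (hh : Measurable h) :
    ∫⁻ z in R.carrier, h (proj g z) ≤ ENNReal.ofReal (4 * a₀ * R.wid) * ∫⁻ s, h s := by
  have hw := R.wid_pos
  set σ := R.slope
  set q := √(1 + σ ^ 2) with hq
  have hq0 : 0 ≤ q := Real.sqrt_nonneg _
  have hq2 : q ≤ 2 := by
    refine Real.sqrt_le_iff.2 ⟨by norm_num, ?_⟩
    have := (sq_le_one_iff_abs_le_one σ).2 hσ
    linarith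
  -- The offsets of the lines along `R` that meet it: length `q * R.wid ≤ 2 * R.wid`, and each line
  -- costs `2 * a₀`.
  set D := Metric.ball (R.center.2 - σ * R.center.1) (q * (1 * R.wid / 2))
  have hD : MeasurableSet D := Metric.isOpen_ball.measurableSet
  have hmeas : Measurable fun z : ℝ × ℝ =>
      D.indicator (1 : ℝ → ENNReal) (z.2 - σ * z.1) * h (proj g z) :=
    ((measurable_one.indicator hD).comp (by fun_prop)).mul (hh.comp (hg.measurable_proj ha))
  rw [← lintegral_indicator R.isOpen_carrier.measurableSet]
  calc ∫⁻ z, R.carrier.indicator (fun z => h (proj g z)) z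
      ≤ ∫⁻ z : ℝ × ℝ, D.indicator (1 : ℝ → ENNReal) (z.2 - σ * z.1) * h (proj g z) := by
        refine lintegral_mono fun z => ?_
        by_cases hz : z ∈ R.carrier
        · have hz2 : z.2 - σ * z.1 ∈ D := by
            have := hz.2
            rw [Metric.mem_ball, Real.dist_eq]
            convert this using 2
            ring
          rw [indicator_of_mem hz, indicator_of_mem hz2, Pi.one_apply, one_mul]
        · rw [indicator_of_notMem hz]
          exact zero_le
    _ = ∫⁻ b, D.indicator (1 : ℝ → ENNReal) b * ∫⁻ x, h (proj g (x, σ * x + b)) := by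
        rw [lintegral_eq_lintegral_shear σ hmeas]
        refine lintegral_congr fun b => ?_
        simp only [add_sub_cancel_left]
        rw [lintegral_const_mul]
        exact hh.comp ((hg.measurable_proj ha).comp (by fun_prop))
    _ ≤ ∫⁻ b, D.indicator (1 : ℝ → ENNReal) b * (ENNReal.ofReal (2 * a₀) * ∫⁻ s, h s) := by
        gcongr with b
        exact hg.lintegral_proj_line_le ha hσ b hh
    _ = ENNReal.ofReal (2 * (q * (1 * R.wid / 2))) * (ENNReal.ofReal (2 * a₀) * ∫⁻ s, h s) := by
        rw [lintegral_mul_const _ (measurable_one.indicator hD), lintegral_indicator_one hD,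
          Real.volume_ball]
    _ ≤ ENNReal.ofReal (4 * a₀ * R.wid) * ∫⁻ s, h s := by
        rw [← mul_assoc, ← ENNReal.ofReal_mul (by positivity)]
        refine mul_le_mul_left (ENNReal.ofReal_le_ofReal ?_) _
        have : 0 < a₀ * R.wid := by positivity
        nlinarith

/-- The bound on `u` holds only almost everywhere on the line. Slicing by horizontal lines carries
the exceptional set to a null set of the plane. -/
theorem IsDistortion.volume_preimage_proj_eq_zero (ha : 0 < a₀)
    (hg : IsDistortion a₀ (1 / 100) g) {N : Set ℝ} (hN : MeasurableSet N) (h0 : volume N = 0) :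
    volume (proj g ⁻¹' N) = 0 := by
  have hm : MeasurableSet (proj g ⁻¹' N) := hg.measurable_proj ha hN
  rw [← lintegral_indicator_one hm, lintegral_eq_lintegral_shear 0 (measurable_one.indicator hm)]
  refine (lintegral_eq_zero_iff' ?_).2 (Filter.Eventually.of_forall fun b => ?_)
  · have hF : Measurable fun p : ℝ × ℝ =>
        (proj g ⁻¹' N).indicator (1 : ℝ × ℝ → ENNReal) (p.2, 0 * p.2 + p.1) :=
      (measurable_one.indicator hm).comp (by fun_prop)
    exact hF.lintegral_prod_right'.aemeasurable
  · have := hg.lintegral_proj_line_le ha (σ := 0) (by simp) b (measurable_one.indicator hN)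
    rw [lintegral_indicator_one hN, h0, mul_zero] at this
    exact le_antisymm this zero_le

/-- An uncertainty interval has half-length at most 1/2, so if it meets [-1/10, 1/10] its centre is
at most 6/10 in modulus; otherwise the popularity is zero. -/
theorem IsDistortion.abs_slope_le_one (ha : 0 < a₀)
    (hg : IsDistortion a₀ (1 / 100) g) (hu : Measurable u) (hu' : ∀ᵐ x : ℝ, |u x| ≤ 1 / 10)
    {R : Rect} {δ : ℝ} (hδ : 0 < δ) (hR : ENNReal.ofReal δ ≤ R.pop u g) : |R.slope| ≤ 1 := by
  by_contra! hcon
  set N := {x : ℝ | ¬ |u x| ≤ 1 / 10}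
  have hN : MeasurableSet N := (measurableSet_le hu.abs measurable_const).compl
  have h0 : volume (proj g ⁻¹' N) = 0 := hg.volume_preimage_proj_eq_zero ha hN hu'
  have hsub : (fun z => u (proj g z)) ⁻¹' R.EX ∩ R.carrier ⊆ proj g ⁻¹' N := by
    rintro z ⟨hz, -⟩
    have hz : u (proj g z) ∈ R.EX := hz
    change ¬ |u (proj g z)| ≤ 1 / 10
    intro h
    have h1 : R.wid / R.len ≤ 1 := (div_le_one R.len_pos).2 R.wid_le_len
    obtain ⟨h2, h3⟩ := abs_le.1 h
    obtain ⟨h4, h5⟩ := hz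
    exact hcon.not_ge (abs_le.2 ⟨by linarith, by linarith⟩)
  have : R.pop u g = 0 := by
    rw [Rect.pop, measure_mono_null hsub h0, ENNReal.zero_div]
  rw [this] at hR
  have := ENNReal.ofReal_pos.2 hδ
  exact hR.not_gt this

/-- The points of the base at which the field points along `R`. -/
def fieldSet (u : ℝ → ℝ) (g : ℝ → ℝ → ℝ) (a₀ : ℝ) (R : Rect) : Set ℝ :=
  u ⁻¹' R.EX ∩ Metric.closedBall (proj g R.center) (2 * a₀ * R.len)

theorem measurableSet_fieldSet (hu : Measurable u) (R : Rect) :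
    MeasurableSet (fieldSet u g a₀ R) :=
  (hu measurableSet_Icc).inter Metric.isClosed_closedBall.measurableSet

theorem IsDistortion.proj_mem_closedBall (ha : 0 < a₀) (hg : IsDistortion a₀ (1 / 100) g)
    {R : Rect} {z : ℝ × ℝ} (hz : z ∈ R.carrier) :
    proj g z ∈ Metric.closedBall (proj g R.center) (2 * a₀ * R.len) := by
  rw [Metric.mem_closedBall, Real.dist_eq]
  refine (hg.abs_proj_sub_le ha z R.center).trans ?_
  obtain ⟨h1, h2⟩ := Rect.abs_sub_center_le hz
  calc a₀ * (|z.1 - R.center.1| + 1 / 100 * |z.2 - R.center.2|)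
      ≤ a₀ * (R.len + 1 * R.len) := by gcongr; norm_num
    _ = 2 * a₀ * R.len := by ring

/-- The popular part of `R` has area at least `δ * len * wid` and `P` maps it into the field set,
whose preimage in `R` has area at most `4 * a₀ * wid` times its length. -/
theorem IsDistortion.len_le_volume_fieldSet (ha : 0 < a₀)
    (hg : IsDistortion a₀ (1 / 100) g) (hu : Measurable u)
    {R : Rect} (hσ : |R.slope| ≤ 1) {δ : ℝ} (hδ : 0 < δ) (hR : ENNReal.ofReal δ ≤ R.pop u g) :
    ENNReal.ofReal (δ * R.len / (4 * a₀)) ≤ volume (fieldSet u g a₀ R) := by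
  have hw := R.wid_pos
  have hl := R.len_pos
  have hE : MeasurableSet (fieldSet u g a₀ R) := measurableSet_fieldSet hu R
  have h1 := hg.lintegral_carrier_comp_proj_le ha hσ (measurable_one.indicator hE)
  rw [lintegral_indicator_one hE, ← lintegral_indicator R.isOpen_carrier.measurableSet] at h1
  have h2 : volume ((fun z => u (proj g z)) ⁻¹' R.EX ∩ R.carrier)
      ≤ ENNReal.ofReal (4 * a₀ * R.wid) * volume (fieldSet u g a₀ R) := by
    refine le_trans ?_ h1
    have hm : MeasurableSet ((fun z => u (proj g z)) ⁻¹' R.EX ∩ R.carrier) :=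
      ((hu.comp (hg.measurable_proj ha)) measurableSet_Icc).inter R.isOpen_carrier.measurableSet
    rw [← lintegral_indicator_one hm]
    refine lintegral_mono fun z => ?_
    by_cases hz : z ∈ (fun z => u (proj g z)) ⁻¹' R.EX ∩ R.carrier
    · have hz' : proj g z ∈ fieldSet u g a₀ R := ⟨hz.1, hg.proj_mem_closedBall ha hz.2⟩
      rw [indicator_of_mem hz, indicator_of_mem hz.2, indicator_of_mem hz']
      rfl
    · rw [indicator_of_notMem hz]
      exact zero_le
  rw [Rect.pop, ENNReal.le_div_iff_mul_le (Or.inl R.volume_carrier_ne_zero)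
    (Or.inl R.volume_carrier_ne_top), R.volume_carrier, ← ENNReal.ofReal_mul hδ.le] at hR
  have h3 := hR.trans h2
  have hpos : 0 < 4 * a₀ * R.wid := by positivity
  rw [mul_comm (ENNReal.ofReal _), ← ENNReal.div_le_iff (ENNReal.ofReal_pos.2 hpos).ne'
    ENNReal.ofReal_ne_top, ← ENNReal.ofReal_div_of_pos hpos] at h3
  refine le_trans (le_of_eq ?_) h3
  congr 1
  field_simp

end

/-- The hypotheses of the covering lemma, for finite families. -/
structure Admissible (u : ℝ → ℝ) (g : ℝ → ℝ → ℝ) (ω δ : ℝ) (s : Finset Rect) : Prop where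
  wid : ∀ R ∈ s, R.wid = ω
  grid : ∀ R ∈ s, ∀ R' ∈ s, R.EX ⊆ R'.EX ∨ R'.EX ⊆ R.EX ∨
    Disjoint (interior R.EX) (interior R'.EX)
  disjoint : ∀ R ∈ s, ∀ R' ∈ s, R ≠ R' → R'.EX ⊆ R.EX → Disjoint R.carrier R'.carrier
  pop : ∀ R ∈ s, ENNReal.ofReal δ ≤ R.pop u g

/-! ### Moments of the counting function of an admissible family. -/

section

variable {a₀ : ℝ} {g : ℝ → ℝ → ℝ} {u : ℝ → ℝ} {ω δ : ℝ} {s t : Finset Rect}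

theorem Admissible.subset (h : Admissible u g ω δ s) (hts : t ⊆ s) : Admissible u g ω δ t where
  wid R hR := h.wid R (hts hR)
  grid R hR R' hR' := h.grid R (hts hR) R' (hts hR')
  disjoint R hR R' hR' := h.disjoint R (hts hR) R' (hts hR')
  pop R hR := h.pop R (hts hR)

/-- Applied with `Q` the base interval for the moment bound, and with `Q` the rectangle itself for
the maximal function. -/
theorem exists_rect_selection {X : Type*} (hw : ∀ R ∈ s, R.wid = ω) (Q : Rect → Set X)
    (hQ : ∀ R, (Q R).Nonempty) :
    ∃ t ⊆ s, (∀ R ∈ s, ∃ R' ∈ t, R'.EX ⊆ R.EX ∧ (Q R ∩ Q R').Nonempty) ∧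
      ∀ R ∈ t, ∀ R' ∈ t, R ≠ R' → R'.EX ⊆ R.EX → Disjoint (Q R) (Q R') := by
  obtain ⟨t, hts, hcov, hsep⟩ := exists_selection s Rect.len
    (fun R R' => R'.EX ⊆ R.EX ∧ (Q R ∩ Q R').Nonempty)
    (fun R _ => ⟨Subset.rfl, by simpa using hQ R⟩)
    (fun R hR R' hR' h => Rect.len_le_len_of_EX_subset ((hw R hR).trans (hw R' hR').symm) h.1)
    (fun R hR R' hR' h hl => ⟨Rect.EX_subset_of_len_le ((hw R hR).trans (hw R' hR').symm) h.1 hl,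
      by rw [inter_comm]; exact h.2⟩)
  refine ⟨t, hts, hcov, fun R hR R' hR' hne hEX => ?_⟩
  rw [disjoint_iff_inter_eq_empty, ← not_nonempty_iff_eq_empty]
  exact fun h => hsep R hR R' hR' hne ⟨hEX, h⟩

/-- Closed intervals with disjoint interiors may share an endpoint. A common point that is the right
endpoint of neither has common interior points just to its right. -/
theorem EX_nested_of_right {R R' : Rect}
    (h : R.EX ⊆ R'.EX ∨ R'.EX ⊆ R.EX ∨ Disjoint (interior R.EX) (interior R'.EX)) {v : ℝ}
    (hv : v ∈ R.EX) (hv' : v ∈ R'.EX) (hr : v < R.slope + R.wid / R.len / 2)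
    (hr' : v < R'.slope + R'.wid / R'.len / 2) : R.EX ⊆ R'.EX ∨ R'.EX ⊆ R.EX := by
  rcases h with h | h | h
  · exact Or.inl h
  · exact Or.inr h
  · exfalso
    obtain ⟨w, hw, hw'⟩ := exists_between (lt_min hr hr')
    rw [Rect.EX, Rect.EX, interior_Icc, interior_Icc] at h
    exact disjoint_left.1 h ⟨hv.1.trans_lt hw, hw'.trans_le (min_le_left _ _)⟩
      ⟨hv'.1.trans_lt hw, hw'.trans_le (min_le_right _ _)⟩

theorem EX_nested_of_left {R R' : Rect}
    (h : R.EX ⊆ R'.EX ∨ R'.EX ⊆ R.EX ∨ Disjoint (interior R.EX) (interior R'.EX)) {v : ℝ}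
    (hv : v ∈ R.EX) (hv' : v ∈ R'.EX) (hr : R.slope - R.wid / R.len / 2 < v)
    (hr' : R'.slope - R'.wid / R'.len / 2 < v) : R.EX ⊆ R'.EX ∨ R'.EX ⊆ R.EX := by
  rcases h with h | h | h
  · exact Or.inl h
  · exact Or.inr h
  · exfalso
    obtain ⟨w, hw, hw'⟩ := exists_between (max_lt hr hr')
    rw [Rect.EX, Rect.EX, interior_Icc, interior_Icc] at h
    exact disjoint_left.1 h ⟨(le_max_left _ _).trans_lt hw, hw'.trans_le hv.2⟩
      ⟨(le_max_right _ _).trans_lt hw, hw'.trans_le hv'.2⟩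

/-- No two rectangles counted at `v` have nested intervals. Hence at most one has `u v` below its
right endpoint, and at most one has `u v` as its right endpoint. -/
theorem sum_indicator_fieldSet_le_two
    (hgrid : ∀ R ∈ t, ∀ R' ∈ t, R.EX ⊆ R'.EX ∨ R'.EX ⊆ R.EX ∨
      Disjoint (interior R.EX) (interior R'.EX))
    (hsep : ∀ R ∈ t, ∀ R' ∈ t, R ≠ R' → R'.EX ⊆ R.EX →
      Disjoint (Metric.closedBall (proj g R.center) (2 * a₀ * R.len))
        (Metric.closedBall (proj g R'.center) (2 * a₀ * R'.len))) (v : ℝ) :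
    ∑ R ∈ t, (fieldSet u g a₀ R).indicator (1 : ℝ → ENNReal) v ≤ 2 := by
  classical
  set p := t.filter fun R => v ∈ fieldSet u g a₀ R
  have h1 : ∑ R ∈ t, (fieldSet u g a₀ R).indicator (1 : ℝ → ENNReal) v = p.card := by
    simp only [indicator_apply, Pi.one_apply, p]
    rw [Finset.sum_boole]
  have key : ∀ R ∈ p, ∀ R' ∈ p, (R.EX ⊆ R'.EX ∨ R'.EX ⊆ R.EX) → R = R' := by
    intro R hR R' hR' h
    obtain ⟨hRt, hRv⟩ := Finset.mem_filter.1 hR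
    obtain ⟨hRt', hRv'⟩ := Finset.mem_filter.1 hR'
    by_contra hne
    rcases h with h | h
    · exact disjoint_left.1 (hsep R' hRt' R hRt (Ne.symm hne) h) hRv'.2 hRv.2
    · exact disjoint_left.1 (hsep R hRt R' hRt' hne h) hRv.2 hRv'.2
  have h2 : (p.filter fun R => u v < R.slope + R.wid / R.len / 2).card ≤ 1 := by
    refine Finset.card_le_one.2 fun R hR R' hR' => ?_
    obtain ⟨hRp, hr⟩ := Finset.mem_filter.1 hR
    obtain ⟨hRp', hr'⟩ := Finset.mem_filter.1 hR'
    obtain ⟨hRt, hRv⟩ := Finset.mem_filter.1 hRp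
    obtain ⟨hRt', hRv'⟩ := Finset.mem_filter.1 hRp'
    exact key R hRp R' hRp' (EX_nested_of_right (hgrid R hRt R' hRt') hRv.1 hRv'.1 hr hr')
  have h3 : (p.filter fun R => ¬ u v < R.slope + R.wid / R.len / 2).card ≤ 1 := by
    refine Finset.card_le_one.2 fun R hR R' hR' => ?_
    obtain ⟨hRp, hr⟩ := Finset.mem_filter.1 hR
    obtain ⟨hRp', hr'⟩ := Finset.mem_filter.1 hR'
    obtain ⟨hRt, hRv⟩ := Finset.mem_filter.1 hRp
    obtain ⟨hRt', hRv'⟩ := Finset.mem_filter.1 hRp'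
    have hpos : ∀ R : Rect, 0 < R.wid / R.len / 2 :=
      fun R => half_pos (div_pos R.wid_pos R.len_pos)
    exact key R hRp R' hRp' (EX_nested_of_left (hgrid R hRt R' hRt') hRv.1 hRv'.1
      (by linarith [hpos R]) (by linarith [hpos R']))
  rw [h1, ← Finset.card_filter_add_card_filter_not (fun R => u v < R.slope + R.wid / R.len / 2)]
  exact_mod_cast Nat.add_le_add h2 h3

/-- On a long rectangle, the shorter rectangles of the family are counted by intervals carrying
essentially disjoint sets. -/
theorem Admissible.lintegral_carrier_sum_pow_le (ha : 0 < a₀)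
    (hg : IsDistortion a₀ (1 / 100) g) (hu : Measurable u) (hu' : ∀ᵐ x : ℝ, |u x| ≤ 1 / 10)
    (hδ : 0 < δ) (h : Admissible u g ω δ s) {R₁ : Rect} (hR₁ : R₁ ∈ s)
    (m : ℕ) :
    ∫⁻ z in R₁.carrier,
        (∑ R ∈ s with R.len ≤ R₁.len, R.carrier.indicator (1 : ℝ × ℝ → ENNReal) z) ^ (m + 1)
      ≤ ((m + 1).factorial : ENNReal) * ENNReal.ofReal (336 * a₀ ^ 2 / δ) ^ (m + 1)
        * ENNReal.ofReal (44 * a₀ ^ 2) * volume R₁.carrier := by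
  classical
  have hl₁ := R₁.len_pos
  have hw₁ := R₁.wid_pos
  set s' := s.filter fun R => R.len ≤ R₁.len ∧ (R.carrier ∩ R₁.carrier).Nonempty
  have hs' : s' ⊆ s := Finset.filter_subset _ _
  have h' := h.subset hs'
  set Q : Rect → Set ℝ := fun R => Metric.closedBall (proj g R.center) (2 * a₀ * R.len)
  have hlen : ∀ R : Rect, 0 < a₀ * R.len := fun R => mul_pos ha R.len_pos
  obtain ⟨t, hts, hcov, hsep⟩ := exists_rect_selection h'.wid Q fun R =>
    ⟨proj g R.center, Metric.mem_closedBall_self (by linarith [hlen R])⟩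
  have ht := h'.subset hts
  -- `P z` is within `2 * a₀ * R.len` of the base centre of `R`, itself within 2 + 2 such units of
  -- the selected centre; 7 makes the total 6 strict.
  set B : Rect → Set ℝ := fun R => Metric.ball (proj g R.center) (7 * a₀ * R.len)
  -- pointwise bound by the counting function of the selected intervals
  have hpt : ∀ z ∈ R₁.carrier,
      ∑ R ∈ s with R.len ≤ R₁.len, R.carrier.indicator (1 : ℝ × ℝ → ENNReal) z
        ≤ ∑ R ∈ t, (B R).indicator (1 : ℝ → ENNReal) (proj g z) := by
    intro z hz
    simp only [indicator_apply, Pi.one_apply]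
    rw [Finset.sum_boole, Finset.sum_boole, Nat.cast_le]
    choose! f hft hfEX hfQ using hcov
    have hmem : ∀ R ∈ (s.filter fun R => R.len ≤ R₁.len).filter fun R => z ∈ R.carrier,
        R ∈ s' ∧ z ∈ R.carrier := fun R hR => by
      obtain ⟨hR, hzR⟩ := Finset.mem_filter.1 hR
      obtain ⟨hRs, hRl⟩ := Finset.mem_filter.1 hR
      exact ⟨Finset.mem_filter.2 ⟨hRs, hRl, z, hzR, hz⟩, hzR⟩
    -- If two rectangles through `z` share the image `f R`, both their intervals contain `(f R).EX`,
    -- so they are nested and the rectangles are disjoint, contradicting `z`.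
    refine Finset.card_le_card_of_injOn f (fun R hR => ?_) fun R hR R' hR' hff => ?_
    · obtain ⟨hRs, hzR⟩ := hmem R hR
      refine Finset.mem_filter.2 ⟨hft R hRs, ?_⟩
      obtain ⟨y, hy, hy'⟩ := hfQ R hRs
      have h1 := hg.proj_mem_closedBall ha hzR
      have h2 := Rect.len_le_len_of_EX_subset
        ((h'.wid R hRs).trans (ht.wid _ (hft R hRs)).symm) (hfEX R hRs)
      have h3 := hlen (f R)
      have h4 := mul_le_mul_of_nonneg_left h2 ha.le
      simp only [Q, B, Metric.mem_closedBall, Metric.mem_ball] at h1 hy hy' ⊢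
      have h5 := dist_triangle (proj g z) (proj g R.center) (proj g (f R).center)
      have h6 := dist_triangle_left (proj g R.center) (proj g (f R).center) y
      linarith
    · obtain ⟨hRs, hzR⟩ := hmem R hR
      obtain ⟨hRs', hzR'⟩ := hmem R' hR'
      by_contra hne
      have hpos : 0 < (f R).wid / (f R).len / 2 :=
        half_pos (div_pos (f R).wid_pos (f R).len_pos)
      have hsl := (f R).slope_mem_EX
      have hi := hfEX R hRs
      have hi' := hfEX R' hRs'
      rw [← hff] at hi'
      have hend : (f R).slope + (f R).wid / (f R).len / 2 ∈ (f R).EX :=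
        ⟨by linarith, le_rfl⟩
      rcases EX_nested_of_right (h'.grid R hRs R' hRs') (hi hsl) (hi' hsl)
        (by linarith [(hi hend).2]) (by linarith [(hi' hend).2]) with hn | hn
      · exact disjoint_left.1 (h'.disjoint R' hRs' R hRs (Ne.symm hne) hn) hzR' hzR
      · exact disjoint_left.1 (h'.disjoint R hRs R' hRs' hne hn) hzR hzR'
  have hσ₁ := hg.abs_slope_le_one ha hu hu' hδ (h.pop R₁ hR₁)
  have hBm : ∀ R, Measurable ((B R).indicator (1 : ℝ → ENNReal)) :=
    fun R => measurable_one.indicator Metric.isOpen_ball.measurableSet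
  -- The density `δ / (28 * a₀ ^ 2)` compares measure `δ * len / (4 * a₀)` with radius `7 * a₀ *
  -- len`; the radius 11 is 7 + 2 + 2.
  have h1D : ∫⁻ v, (∑ R ∈ t, (B R).indicator (1 : ℝ → ENNReal) v) ^ (m + 1)
      ≤ ((m + 1).factorial : ENNReal) * ENNReal.ofReal (12 / (δ / (28 * a₀ ^ 2))) ^ (m + 1)
        * ENNReal.ofReal (11 * a₀ * R₁.len) := by
    refine lintegral_sum_ball_pow_le (by positivity) _ _ (fieldSet u g a₀)
      (fun R => measurableSet_fieldSet hu R) m t (fun R _ => by linarith [hlen R])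
      (fun R _ => ?_) (fun R hR => ?_) (sum_indicator_fieldSet_le_two ht.grid hsep)
      (X := proj g R₁.center) (by positivity) (fun R hR => ?_)
    · refine inter_subset_right.trans (Metric.closedBall_subset_ball ?_)
      linarith [hlen R]
    · refine le_trans (le_of_eq ?_) (hg.len_le_volume_fieldSet ha hu
        (hg.abs_slope_le_one ha hu hu' hδ (ht.pop R hR)) hδ (ht.pop R hR))
      congr 1
      field_simp
      ring
    · obtain ⟨-, hRl, y, hy, hy₁⟩ := Finset.mem_filter.1 (hts hR)
      have h1 := hg.proj_mem_closedBall ha hy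
      have h2 := hg.proj_mem_closedBall ha hy₁
      have h3 := mul_le_mul_of_nonneg_left hRl ha.le
      intro x hx
      simp only [Metric.mem_closedBall, Metric.mem_ball] at h1 h2 hx ⊢
      have h5 := dist_triangle x (proj g R.center) (proj g R₁.center)
      have h6 := dist_triangle_left (proj g R.center) (proj g R₁.center) (proj g y)
      linarith
  calc ∫⁻ z in R₁.carrier,
        (∑ R ∈ s with R.len ≤ R₁.len, R.carrier.indicator (1 : ℝ × ℝ → ENNReal) z) ^ (m + 1)
      ≤ ∫⁻ z in R₁.carrier, (∑ R ∈ t, (B R).indicator (1 : ℝ → ENNReal) (proj g z)) ^ (m + 1) := by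
        refine setLIntegral_mono' R₁.isOpen_carrier.measurableSet fun z hz => ?_
        exact pow_le_pow_left₀ zero_le (hpt z hz) _
    _ ≤ ENNReal.ofReal (4 * a₀ * R₁.wid)
        * ∫⁻ v, (∑ R ∈ t, (B R).indicator (1 : ℝ → ENNReal) v) ^ (m + 1) :=
        hg.lintegral_carrier_comp_proj_le ha hσ₁
          (h := fun v => (∑ R ∈ t, (B R).indicator (1 : ℝ → ENNReal) v) ^ (m + 1))
          ((Finset.measurable_fun_sum _ fun j _ => hBm j).pow_const _)
    _ ≤ ENNReal.ofReal (4 * a₀ * R₁.wid) * (((m + 1).factorial : ENNReal)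
        * ENNReal.ofReal (12 / (δ / (28 * a₀ ^ 2))) ^ (m + 1)
        * ENNReal.ofReal (11 * a₀ * R₁.len)) := by gcongr
    _ = ((m + 1).factorial : ENNReal) * ENNReal.ofReal (336 * a₀ ^ 2 / δ) ^ (m + 1)
        * (ENNReal.ofReal (4 * a₀ * R₁.wid) * ENNReal.ofReal (11 * a₀ * R₁.len)) := by
        rw [show 12 / (δ / (28 * a₀ ^ 2)) = 336 * a₀ ^ 2 / δ by field_simp; norm_num]
        ring
    _ = _ := by
        rw [R₁.volume_carrier, mul_assoc (_ * _), ← ENNReal.ofReal_mul (by positivity),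
          ← ENNReal.ofReal_mul (by positivity)]
        congr 2
        ring

/-- One factor of the counting function is spent on restricting to `R₁`, so the power `m + 2` costs
only `m + 1` factors of `1 / δ`. -/
theorem Admissible.lintegral_sum_pow_le (ha : 0 < a₀)
    (hg : IsDistortion a₀ (1 / 100) g) (hu : Measurable u) (hu' : ∀ᵐ x : ℝ, |u x| ≤ 1 / 10)
    (hδ : 0 < δ) (h : Admissible u g ω δ s) (m : ℕ) :
    ∫⁻ z, (∑ R ∈ s, R.carrier.indicator (1 : ℝ × ℝ → ENNReal) z) ^ (m + 2)
      ≤ ((m + 2).factorial : ENNReal) * ENNReal.ofReal (336 * a₀ ^ 2 / δ) ^ (m + 1)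
        * ENNReal.ofReal (44 * a₀ ^ 2) * ∑ R ∈ s, volume R.carrier := by
  classical
  have hm : ∀ R : Rect, Measurable (R.carrier.indicator (1 : ℝ × ℝ → ENNReal)) :=
    fun R => measurable_one.indicator R.isOpen_carrier.measurableSet
  have hm' : ∀ R₁ : Rect, Measurable fun z => (∑ R ∈ s with R.len ≤ R₁.len,
      R.carrier.indicator (1 : ℝ × ℝ → ENNReal) z) ^ (m + 1) :=
    fun R₁ => (Finset.measurable_fun_sum _ fun R _ => hm R).pow_const _
  have hmm : ∀ R₁ : Rect, Measurable fun z => R₁.carrier.indicator (1 : ℝ × ℝ → ENNReal) z *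
      (∑ R ∈ s with R.len ≤ R₁.len, R.carrier.indicator (1 : ℝ × ℝ → ENNReal) z) ^ (m + 1) :=
    fun R₁ => (hm R₁).mul (hm' R₁)
  calc ∫⁻ z, (∑ R ∈ s, R.carrier.indicator (1 : ℝ × ℝ → ENNReal) z) ^ (m + 2)
      ≤ ∫⁻ z, ((m + 2 : ℕ) : ENNReal) * ∑ R₁ ∈ s, R₁.carrier.indicator (1 : ℝ × ℝ → ENNReal) z
        * (∑ R ∈ s with R.len ≤ R₁.len, R.carrier.indicator (1 : ℝ × ℝ → ENNReal) z) ^ (m + 1) := by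
        refine lintegral_mono fun z => ?_
        exact_mod_cast sum_pow_succ_le s Rect.len
          (fun R => R.carrier.indicator (1 : ℝ × ℝ → ENNReal) z) (m + 1)
    _ = ((m + 2 : ℕ) : ENNReal) * ∑ R₁ ∈ s, ∫⁻ z in R₁.carrier,
        (∑ R ∈ s with R.len ≤ R₁.len, R.carrier.indicator (1 : ℝ × ℝ → ENNReal) z) ^ (m + 1) := by
        rw [lintegral_const_mul _ (Finset.measurable_fun_sum _ fun R _ => hmm R),
          lintegral_finsetSum _ fun R _ => hmm R]
        congr 1
        refine Finset.sum_congr rfl fun R _ => ?_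
        rw [← lintegral_indicator R.isOpen_carrier.measurableSet]
        refine lintegral_congr fun z => ?_
        by_cases hz : z ∈ R.carrier
        · rw [indicator_of_mem hz, indicator_of_mem hz, Pi.one_apply, one_mul]
        · rw [indicator_of_notMem hz, indicator_of_notMem hz, zero_mul]
    _ ≤ ((m + 2 : ℕ) : ENNReal) * ∑ R₁ ∈ s, ((m + 1).factorial : ENNReal)
        * ENNReal.ofReal (336 * a₀ ^ 2 / δ) ^ (m + 1)
        * ENNReal.ofReal (44 * a₀ ^ 2) * volume R₁.carrier := by
        gcongr with R hR
        exact h.lintegral_carrier_sum_pow_le ha hg hu hu' hδ hR m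
    _ = _ := by
        rw [← Finset.mul_sum, Nat.factorial_succ (m + 1)]
        push_cast
        ring

end

/-! ### Duality and the covering lemma. -/

/-- Young's inequality for the conjugate exponents, without sharp constants: one term alone
suffices, according to the larger of `K * x` and `y ^ (m + 1)`. -/
theorem mul_le_rpow_add_pow (x y : ENNReal) {K : ℝ} (hK : 0 < K) (m : ℕ) :
    x * y ≤ ENNReal.ofReal (K ^ (1 / (m + 1 : ℝ))) * x ^ (1 + 1 / (m + 1 : ℝ))
      + ENNReal.ofReal K⁻¹ * y ^ (m + 2) := by
  have he : 0 < 1 / (m + 1 : ℝ) := by positivity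
  rcases le_total y ((ENNReal.ofReal K * x) ^ (1 / (m + 1 : ℝ))) with h | h
  · refine le_add_right ?_
    calc x * y ≤ x * (ENNReal.ofReal K * x) ^ (1 / (m + 1 : ℝ)) := by gcongr
      _ = _ := by
        rw [ENNReal.mul_rpow_of_nonneg _ _ he.le, ENNReal.rpow_add_of_nonneg _ _ zero_le_one he.le,
          ENNReal.rpow_one, ENNReal.ofReal_rpow_of_pos hK]
        ring
  · refine le_add_left ?_
    have h1 : ENNReal.ofReal K * x ≤ y ^ (m + 1) := by
      have := ENNReal.rpow_le_rpow h (by positivity : (0 : ℝ) ≤ m + 1)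
      rw [← ENNReal.rpow_mul, one_div_mul_cancel (by positivity), ENNReal.rpow_one] at this
      refine this.trans (le_of_eq ?_)
      exact_mod_cast ENNReal.rpow_natCast y (m + 1)
    calc x * y = ENNReal.ofReal K⁻¹ * (ENNReal.ofReal K * x) * y := by
          rw [← mul_assoc (ENNReal.ofReal K⁻¹), ← ENNReal.ofReal_mul (by positivity),
            inv_mul_cancel₀ hK.ne', ENNReal.ofReal_one, one_mul]
      _ ≤ ENNReal.ofReal K⁻¹ * y ^ (m + 1) * y := by gcongr
      _ = _ := by ring

/-- The constant of the covering lemma. -/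
def coverConst (a₀ : ℝ) (m : ℕ) : ℝ :=
  2 * (2 * ((m + 2).factorial * (336 * a₀ ^ 2) ^ (m + 1) * (44 * a₀ ^ 2))) ^ (1 / (m + 1 : ℝ))

theorem coverConst_pos {a₀ : ℝ} (ha : 0 < a₀) (m : ℕ) : 0 < coverConst a₀ m := by
  have : (0 : ℝ) < (m + 2).factorial := by exact_mod_cast (m + 2).factorial_pos
  rw [coverConst]
  positivity

/-- The covering lemma for finite families, with averages of a function. -/
theorem Admissible.sum_volume_le {a₀ : ℝ} {g : ℝ → ℝ → ℝ} {u : ℝ → ℝ} {ω δ : ℝ}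
    {s : Finset Rect} (ha : 0 < a₀)
    (hg : IsDistortion a₀ (1 / 100) g) (hu : Measurable u) (hu' : ∀ᵐ x : ℝ, |u x| ≤ 1 / 10)
    (hδ : 0 < δ) (hs : Admissible u g ω δ s) (m : ℕ) {h : ℝ × ℝ → ENNReal} (hh : Measurable h)
    {l : ℝ} (hl : 0 < l)
    (hav : ∀ R ∈ s, ENNReal.ofReal l * volume R.carrier ≤ ∫⁻ z in R.carrier, h z) :
    ∑ R ∈ s, volume R.carrier ≤ ENNReal.ofReal (coverConst a₀ m / (δ * l ^ (1 + 1 / (m + 1 : ℝ))))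
      * ∫⁻ z, h z ^ (1 + 1 / (m + 1 : ℝ)) := by
  set e : ℝ := 1 / (m + 1 : ℝ) with he_def
  have he : 0 < e := by positivity
  have hf : (0 : ℝ) < (m + 2).factorial := by exact_mod_cast (m + 2).factorial_pos
  set X := ∑ R ∈ s, volume R.carrier
  set I := ∫⁻ z, h z ^ (1 + e)
  set c : ℝ := (m + 2).factorial * (336 * a₀ ^ 2) ^ (m + 1) * (44 * a₀ ^ 2) with hc_def
  have hc : 0 < c := by positivity
  have hX : X ≠ ⊤ := ENNReal.sum_ne_top.2 fun R _ => R.volume_carrier_ne_top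
  -- Chosen so that the moment term becomes `l / 2 * X`, absorbed on the left because `X` is finite.
  set K : ℝ := 2 * c / (δ ^ (m + 1) * l) with hK_def
  have hK : 0 < K := by positivity
  have hm : ∀ R : Rect, Measurable (R.carrier.indicator (1 : ℝ × ℝ → ENNReal)) :=
    fun R => measurable_one.indicator R.isOpen_carrier.measurableSet
  have hN : Measurable fun z => ∑ R ∈ s, R.carrier.indicator (1 : ℝ × ℝ → ENNReal) z :=
    Finset.measurable_fun_sum _ fun R _ => hm R
  have hcore : ∫⁻ z, (∑ R ∈ s, R.carrier.indicator (1 : ℝ × ℝ → ENNReal) z) ^ (m + 2)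
      ≤ ENNReal.ofReal (c / δ ^ (m + 1)) * X := by
    refine (hs.lintegral_sum_pow_le ha hg hu hu' hδ m).trans (le_of_eq ?_)
    congr 1
    rw [← ENNReal.ofReal_pow (by positivity), ← ENNReal.ofReal_natCast,
      ← ENNReal.ofReal_mul (by positivity), ← ENNReal.ofReal_mul (by positivity)]
    congr 1
    rw [hc_def, div_pow]
    field_simp
  have h1 : ENNReal.ofReal l * X ≤ ENNReal.ofReal (K ^ e) * I + ENNReal.ofReal (l / 2) * X := by
    calc ENNReal.ofReal l * X = ∑ R ∈ s, ENNReal.ofReal l * volume R.carrier := Finset.mul_sum _ _ _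
      _ ≤ ∑ R ∈ s, ∫⁻ z in R.carrier, h z := Finset.sum_le_sum hav
      _ = ∫⁻ z, h z * ∑ R ∈ s, R.carrier.indicator (1 : ℝ × ℝ → ENNReal) z := by
          simp_rw [Finset.mul_sum]
          have : ∀ R ∈ s, Measurable fun z =>
              h z * R.carrier.indicator (1 : ℝ × ℝ → ENNReal) z := fun R _ => hh.mul (hm R)
          rw [lintegral_finsetSum _ this]
          refine Finset.sum_congr rfl fun R _ => ?_
          rw [← lintegral_indicator R.isOpen_carrier.measurableSet]
          refine lintegral_congr fun z => ?_
          by_cases hz : z ∈ R.carrier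
          · rw [indicator_of_mem hz, indicator_of_mem hz, Pi.one_apply, mul_one]
          · rw [indicator_of_notMem hz, indicator_of_notMem hz, mul_zero]
      _ ≤ ∫⁻ z, (ENNReal.ofReal (K ^ e) * h z ^ (1 + e) + ENNReal.ofReal K⁻¹ *
            (∑ R ∈ s, R.carrier.indicator (1 : ℝ × ℝ → ENNReal) z) ^ (m + 2)) :=
          lintegral_mono fun z => mul_le_rpow_add_pow _ _ hK m
      _ = ENNReal.ofReal (K ^ e) * I + ENNReal.ofReal K⁻¹ *
            ∫⁻ z, (∑ R ∈ s, R.carrier.indicator (1 : ℝ × ℝ → ENNReal) z) ^ (m + 2) := by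
          rw [lintegral_add_left ((hh.pow_const _).const_mul _),
            lintegral_const_mul _ (hh.pow_const _), lintegral_const_mul _ (hN.pow_const _)]
      _ ≤ ENNReal.ofReal (K ^ e) * I + ENNReal.ofReal K⁻¹ *
            (ENNReal.ofReal (c / δ ^ (m + 1)) * X) := by gcongr
      _ = _ := by
          rw [← mul_assoc (ENNReal.ofReal K⁻¹), ← ENNReal.ofReal_mul (by positivity)]
          congr 3
          rw [hK_def]
          field_simp
  have h2 : ENNReal.ofReal (l / 2) * X ≤ ENNReal.ofReal (K ^ e) * I := by
    refine (ENNReal.add_le_add_iff_right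
      (ENNReal.mul_ne_top ENNReal.ofReal_ne_top hX : ENNReal.ofReal (l / 2) * X ≠ ⊤)).1 ?_
    refine le_trans (le_of_eq ?_) h1
    rw [← add_mul, ← ENNReal.ofReal_add (by positivity) (by positivity), add_halves]
  calc X = ENNReal.ofReal (2 / l) * (ENNReal.ofReal (l / 2) * X) := by
        rw [← mul_assoc, ← ENNReal.ofReal_mul (by positivity),
          show 2 / l * (l / 2) = 1 by field_simp, ENNReal.ofReal_one, one_mul]
    _ ≤ ENNReal.ofReal (2 / l) * (ENNReal.ofReal (K ^ e) * I) := by gcongr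
    _ = _ := by
        rw [← mul_assoc, ← ENNReal.ofReal_mul (by positivity)]
        congr 2
        -- This is where the dependence on `1 / δ` becomes linear.
        have hδe : (δ ^ (m + 1)) ^ e = δ := by
          rw [← Real.rpow_natCast, ← Real.rpow_mul hδ.le, he_def]
          push_cast
          rw [mul_one_div_cancel (by positivity), Real.rpow_one]
        rw [hK_def, Real.div_rpow (by positivity) (by positivity),
          Real.mul_rpow (by positivity) hl.le, hδe, Real.rpow_add hl, Real.rpow_one,
          show coverConst a₀ m = 2 * (2 * c) ^ e from rfl]
        field_simp

theorem exists_one_add_inv_lt {p : ℝ} (hp : 1 < p) : ∃ m : ℕ, 1 + 1 / (m + 1 : ℝ) < p := by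
  obtain ⟨m, hm⟩ := exists_nat_one_div_lt (sub_pos.2 hp)
  exact ⟨m, by linarith⟩

/-- The covering lemma for arbitrary families. -/
theorem tsum_volume_le {a₀ : ℝ} {g : ℝ → ℝ → ℝ} {u : ℝ → ℝ} {C ω δ l p : ℝ} (ha : 0 < a₀)
    (hg : IsDistortion a₀ (1 / 100) g) (hu : Measurable u) (hu' : ∀ᵐ x : ℝ, |u x| ≤ 1 / 10)
    (hC : 5 ≤ C) (hδ : 0 < δ) (hl : 0 < l) {m : ℕ} (hm : 1 + 1 / (m + 1 : ℝ) ≤ p)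
    {F : Set (ℝ × ℝ)} (hF : MeasurableSet F) {R₀ : Set Rect}
    (hwid : ∀ R ∈ R₀, R.wid = ω)
    (hgrid : ∀ R ∈ R₀, ∀ R' ∈ R₀, R.EX ⊆ R'.EX ∨ R'.EX ⊆ R.EX ∨
      Disjoint (interior R.EX) (interior R'.EX))
    (hinc : R₀.Pairwise fun R R' => ¬ Rect.Below C R R')
    (hpop : ∀ R ∈ R₀, ENNReal.ofReal δ ≤ R.pop u g)
    (hav : ∀ R ∈ R₀, ENNReal.ofReal l ≤ volume (F ∩ R.carrier) / volume R.carrier) :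
    ∑' R : R₀, volume R.1.carrier
      ≤ ENNReal.ofReal (coverConst a₀ m) * volume F / ENNReal.ofReal (δ * l ^ p) := by
  classical
  -- Any rectangle of the family forces `l ≤ 1`, which permits raising the exponent of `l` to `p`.
  rcases R₀.eq_empty_or_nonempty with rfl | ⟨R₁, hR₁⟩
  · simp
  have hl1 : l ≤ 1 := by
    have : volume (F ∩ R₁.carrier) / volume R₁.carrier ≤ 1 :=
      ENNReal.div_le_of_le_mul (by rw [one_mul]; exact measure_mono inter_subset_right)
    simpa using (hav R₁ hR₁).trans this
  have hc := coverConst_pos ha m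
  rw [ENNReal.tsum_eq_iSup_sum]
  refine iSup_le fun t => ?_
  have hmem : ∀ R ∈ t.image Subtype.val, R ∈ R₀ := fun R hR => by
    obtain ⟨R', -, rfl⟩ := Finset.mem_image.1 hR
    exact R'.2
  have had : Admissible u g ω δ (t.image Subtype.val) :=
    { wid := fun R hR => hwid R (hmem R hR)
      grid := fun R hR R' hR' => hgrid R (hmem R hR) R' (hmem R' hR')
      pop := fun R hR => hpop R (hmem R hR)
      disjoint := fun R hR R' hR' hne hEX => by
        rw [disjoint_iff_inter_eq_empty, ← not_nonempty_iff_eq_empty]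
        intro hmeet
        have hww := (hwid R (hmem R hR)).trans (hwid R' (hmem R' hR')).symm
        exact hinc (hmem R hR) (hmem R' hR') hne
          ⟨(Rect.carrier_subset_dilate hww hEX hmeet).trans (R'.dilate_mono hC), hEX⟩ }
  have key := had.sum_volume_le ha hg hu hu' hδ m (measurable_one.indicator hF) hl
    fun R hR => by
      rw [lintegral_indicator_one hF, Measure.restrict_apply hF]
      exact (ENNReal.le_div_iff_mul_le (Or.inl R.volume_carrier_ne_zero)
        (Or.inl R.volume_carrier_ne_top)).1 (hav R (hmem R hR))
  rw [Finset.sum_image (fun _ _ _ _ h => Subtype.val_injective h)] at key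
  refine key.trans ?_
  have hI : ∫⁻ z, F.indicator (1 : ℝ × ℝ → ENNReal) z ^ (1 + 1 / (m + 1 : ℝ)) = volume F := by
    rw [← lintegral_indicator_one hF]
    refine lintegral_congr fun z => ?_
    by_cases hz : z ∈ F
    · rw [indicator_of_mem hz, Pi.one_apply, ENNReal.one_rpow]
    · rw [indicator_of_notMem hz, ENNReal.zero_rpow_of_pos (by positivity)]
  rw [hI, ENNReal.mul_div_right_comm, ← ENNReal.ofReal_div_of_pos (by positivity)]
  refine mul_le_mul_left (ENNReal.ofReal_le_ofReal ?_) _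
  exact div_le_div_of_nonneg_left hc.le (by positivity)
    (mul_le_mul_of_nonneg_left (Real.rpow_le_rpow_of_exponent_ge hl hl1 hm) hδ.le)

/-! ### Passage to dyadic uncertainty intervals. -/

theorem Icc_dyadic_nested (k k' : ℕ) (j j' : ℤ) :
    Icc ((j : ℝ) / 2 ^ k) ((j + 1) / 2 ^ k) ⊆ Icc ((j' : ℝ) / 2 ^ k') ((j' + 1) / 2 ^ k') ∨
      Icc ((j' : ℝ) / 2 ^ k') ((j' + 1) / 2 ^ k') ⊆ Icc ((j : ℝ) / 2 ^ k) ((j + 1) / 2 ^ k) ∨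
      Disjoint (interior (Icc ((j : ℝ) / 2 ^ k) ((j + 1) / 2 ^ k)))
        (interior (Icc ((j' : ℝ) / 2 ^ k') ((j' + 1) / 2 ^ k'))) := by
  have key : ∀ (k k' : ℕ) (j j' : ℤ), k ≤ k' →
      Icc ((j' : ℝ) / 2 ^ k') ((j' + 1) / 2 ^ k') ⊆ Icc ((j : ℝ) / 2 ^ k) ((j + 1) / 2 ^ k) ∨
      Disjoint (interior (Icc ((j : ℝ) / 2 ^ k) ((j + 1) / 2 ^ k)))
        (interior (Icc ((j' : ℝ) / 2 ^ k') ((j' + 1) / 2 ^ k'))) := by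
    intro k k' j j' hk
    obtain ⟨d, rfl⟩ := Nat.exists_eq_add_of_le hk
    have h1 : ∀ x : ℝ, x / 2 ^ k = x * 2 ^ d / 2 ^ (k + d) := fun x => by
      rw [pow_add]; field_simp
    have hpos : (0 : ℝ) < 2 ^ (k + d) := by positivity
    rw [h1, h1]
    by_cases ha : j * 2 ^ d ≤ j'
    · by_cases hb : j' + 1 ≤ (j + 1) * 2 ^ d
      · left
        have ha' : (j : ℝ) * 2 ^ d ≤ j' := by exact_mod_cast ha
        have hb' : (j' : ℝ) + 1 ≤ (j + 1) * 2 ^ d := by exact_mod_cast hb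
        exact Icc_subset_Icc (by gcongr) (by gcongr)
      · right
        have hb' : ((j : ℝ) + 1) * 2 ^ d ≤ j' := by
          have : (j + 1) * 2 ^ d ≤ j' := by linarith
          exact_mod_cast this
        rw [interior_Icc, interior_Icc, Ioo_disjoint_Ioo]
        exact (min_le_left _ _).trans (le_trans (by gcongr) (le_max_right _ _))
    · right
      have ha' : (j' : ℝ) + 1 ≤ j * 2 ^ d := by
        have : j' + 1 ≤ j * 2 ^ d := by linarith
        exact_mod_cast this
      rw [interior_Icc, interior_Icc, Ioo_disjoint_Ioo]
      exact (min_le_right _ _).trans (le_trans (by gcongr) (le_max_left _ _))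
  rcases le_total k k' with h | h
  · exact Or.inr (key k k' j j' h)
  · rcases key k' k j' j h with h | h
    · exact Or.inl h
    · exact Or.inr (Or.inr h.symm)

/-- The uncertainty interval of `R` is a dyadic interval. -/
def Rect.IsDyadic (R : Rect) : Prop :=
  ∃ (k : ℕ) (j : ℤ), R.EX = Icc ((j : ℝ) / 2 ^ k) ((j + 1) / 2 ^ k)

theorem Rect.IsDyadic.nested {R R' : Rect} (h : R.IsDyadic) (h' : R'.IsDyadic) :
    R.EX ⊆ R'.EX ∨ R'.EX ⊆ R.EX ∨ Disjoint (interior R.EX) (interior R'.EX) := by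
  obtain ⟨k, j, hj⟩ := h
  obtain ⟨k', j', hj'⟩ := h'
  rw [hj, hj']
  exact Icc_dyadic_nested k k' j j'

/-- Over half the length of `R` the directions drift apart by at most 5/4 of its width, and 1/2 +
5/4 < 2, the half-width of `R'`. -/
theorem Rect.carrier_subset_carrier {R R' : Rect} (hc : R'.center = R.center)
    (hl : 2 * R.len ≤ R'.len) (hw : R'.wid = 4 * R.wid)
    (hs : |R'.slope - R.slope| ≤ 5 / 2 * (R.wid / R.len)) : R.carrier ⊆ R'.carrier := by
  intro z hz
  obtain ⟨hz1, hz2⟩ := hz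
  have hlpos := R.len_pos
  have hwl := R.wid_le_len
  have hw0 := R.wid_pos
  set σ := R.slope
  set τ := R'.slope
  set p := √(1 + σ ^ 2) with hp
  set q := √(1 + τ ^ 2) with hq
  have hp2 : p ^ 2 = 1 + σ ^ 2 := Real.sq_sqrt (by positivity)
  have hq2 : q ^ 2 = 1 + τ ^ 2 := Real.sq_sqrt (by positivity)
  have hp1 : 1 ≤ p := Real.one_le_sqrt.2 (by nlinarith [sq_nonneg σ])
  have hq1 : 1 ≤ q := Real.one_le_sqrt.2 (by nlinarith [sq_nonneg τ])
  have hd : |τ - σ| * R.len ≤ 5 / 2 * R.wid := by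
    calc |τ - σ| * R.len ≤ 5 / 2 * (R.wid / R.len) * R.len := by gcongr
      _ = 5 / 2 * R.wid := by field_simp
  have hcos : |1 + σ * τ| ≤ p * q := by
    refine abs_le_of_sq_le_sq ?_ (by positivity)
    rw [mul_pow, hp2, hq2]
    nlinarith [sq_nonneg (σ - τ)]
  have hsin : |τ - σ| ≤ p * q := by
    refine abs_le_of_sq_le_sq ?_ (by positivity)
    rw [mul_pow, hp2, hq2]
    nlinarith [sq_nonneg (1 + σ * τ)]
  have hsin' : |τ - σ| ≤ p * q * |τ - σ| := by
    have : 1 ≤ p * q := by nlinarith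
    nlinarith [abs_nonneg (τ - σ)]
  set α := (z.1 - R.center.1) + σ * (z.2 - R.center.2) with hα
  set β := (z.2 - R.center.2) - σ * (z.1 - R.center.1) with hβ
  have e1 : (z.1 - R.center.1) + τ * (z.2 - R.center.2)
      = ((1 + σ * τ) * α + (τ - σ) * β) / p ^ 2 := by
    rw [hα, hβ, hp2]; field_simp; ring
  have e2 : (z.2 - R.center.2) - τ * (z.1 - R.center.1)
      = ((1 + σ * τ) * β - (τ - σ) * α) / p ^ 2 := by
    rw [hα, hβ, hp2]; field_simp; ring
  have hp2pos : 0 < p ^ 2 := by positivity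
  have hqpos : 0 < q := by linarith
  have hα' : |α| ≤ p * (R.len / 2) := by linarith
  have hβ' : |β| < p * (R.wid / 2) := by linarith
  have hβ'' : |β| < p * (R.len / 2) := hβ'.trans_le (by gcongr)
  refine ⟨?_, ?_⟩
  · change |(z.1 - R'.center.1) + τ * (z.2 - R'.center.2)| < q * _
    rw [hc, e1, abs_div, abs_of_pos hp2pos, div_lt_iff₀ hp2pos]
    have hpq : 0 < p * q := by positivity
    calc |(1 + σ * τ) * α + (τ - σ) * β| ≤ |1 + σ * τ| * |α| + |τ - σ| * |β| := by
          rw [← abs_mul, ← abs_mul]; exact abs_add_le _ _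
      _ ≤ (p * q) * (p * (R.len / 2)) + (p * q) * |β| := by gcongr
      _ < (p * q) * (p * (R.len / 2)) + (p * q) * (p * (R.len / 2)) := by gcongr
      _ = q * (1 * (2 * R.len) / 2) * p ^ 2 := by ring
      _ ≤ q * (1 * R'.len / 2) * p ^ 2 := by gcongr
  · change |(z.2 - R'.center.2) - τ * (z.1 - R'.center.1)| < q * _
    rw [hc, e2, abs_div, abs_of_pos hp2pos, div_lt_iff₀ hp2pos, hw]
    calc |(1 + σ * τ) * β - (τ - σ) * α| ≤ |1 + σ * τ| * |β| + |τ - σ| * |α| := by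
          rw [← abs_mul, ← abs_mul]; exact abs_sub _ _
      _ ≤ (p * q) * (p * (R.wid / 2)) + (p * q * |τ - σ|) * (p * (R.len / 2)) := by gcongr
      _ = p ^ 2 * q * (R.wid / 2 + |τ - σ| * R.len / 2) := by ring
      _ ≤ p ^ 2 * q * (R.wid / 2 + 5 / 2 * R.wid / 2) := by gcongr
      _ < p ^ 2 * q * (2 * R.wid) := by
          refine mul_lt_mul_of_pos_left ?_ (by positivity)
          linarith
      _ = q * (1 * (4 * R.wid) / 2) * p ^ 2 := by ring

/-- Every popular rectangle sits in a slightly less popular one of comparable size whose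
uncertainty interval is dyadic. -/
theorem exists_dyadic_rect {g : ℝ → ℝ → ℝ} {u : ℝ → ℝ} {δ : ℝ} (hδ : 0 < δ) {R : Rect}
    (hR : ENNReal.ofReal δ ≤ R.pop u g) :
    ∃ R' : Rect, R'.wid = 4 * R.wid ∧ R'.IsDyadic ∧ ENNReal.ofReal (δ / 32) ≤ R'.pop u g ∧
      R.carrier ⊆ R'.carrier ∧ volume R'.carrier ≤ 16 * volume R.carrier := by
  have hlpos := R.len_pos
  have hwl := R.wid_le_len
  have hw0 := R.wid_pos
  set ε := R.wid / R.len with hε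
  have hεpos : 0 < ε := div_pos hw0 hlpos
  have hε1 : ε ≤ 1 := (div_le_one hlpos).2 hwl
  obtain ⟨k, hk1, hk2⟩ := exists_nat_pow_near_of_lt_one hεpos hε1 (y := (1 / 2 : ℝ))
    (by norm_num) (by norm_num)
  have h2k : (0 : ℝ) < 2 ^ k := by positivity
  rw [pow_succ, one_div, inv_pow] at hk1
  rw [one_div, inv_pow] at hk2
  set η : ℝ := (2 ^ k)⁻¹ with hη
  have hηpos : 0 < η := by positivity
  have hlen1 : 2 * R.len ≤ 4 * R.wid * 2 ^ k := by
    have h1 : R.len * η ≤ 2 * R.wid := by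
      calc R.len * η ≤ R.len * (2 * ε) := by gcongr; linarith
        _ = 2 * R.wid := by rw [hε]; field_simp
    calc 2 * R.len = 2 * (R.len * η) * 2 ^ k := by rw [hη]; field_simp
      _ ≤ 2 * (2 * R.wid) * 2 ^ k := by gcongr
      _ = 4 * R.wid * 2 ^ k := by ring
  have hlen2 : R.wid * 2 ^ k ≤ R.len := by
    calc R.wid * 2 ^ k = R.len * ε * 2 ^ k := by rw [hε]; field_simp
      _ ≤ R.len * η * 2 ^ k := by gcongr
      _ = R.len := by rw [hη]; field_simp
  let T : ℤ → Rect := fun i =>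
    { center := R.center
      slope := (i + 1 / 2) / 2 ^ k
      len := 4 * R.wid * 2 ^ k
      wid := 4 * R.wid
      wid_pos := by positivity
      wid_le_len := le_mul_of_one_le_right (by positivity) (one_le_pow₀ (by norm_num)) }
  have hTEX : ∀ i, (T i).EX = Icc ((i : ℝ) / 2 ^ k) ((i + 1) / 2 ^ k) := fun i => by
    simp only [Rect.EX, T]
    congr 1 <;> field_simp <;> ring
  set a := R.slope - ε / 2 with ha
  set j := ⌊a / η⌋ with hj
  have hj1 : j * η ≤ a := (le_div_iff₀ hηpos).1 (Int.floor_le _)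
  have hj2 : a < (j + 1) * η := (div_lt_iff₀ hηpos).1 (Int.lt_floor_add_one _)
  -- As `ε ≤ η`, the dyadic interval holding the left endpoint and the next one suffice. One of them
  -- keeps half the popularity, and the area grows by at most 16, whence `δ / 32`.
  have hcover : R.EX ⊆ (T j).EX ∪ (T (j + 1)).EX := by
    rintro v ⟨hv1, hv2⟩
    rw [← hε] at hv1 hv2
    rw [hTEX, hTEX]
    simp only [div_eq_mul_inv, ← hη]
    push_cast
    rcases le_total v ((j + 1) * η) with h | h
    · exact Or.inl ⟨by linarith, h⟩
    · exact Or.inr ⟨h, by linarith⟩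
  -- The worst case is `j + 1`, with error at most `3 * η / 2 - ε / 2`, where `η < 2 * ε`.
  have hslope : ∀ i : ℤ, i = j ∨ i = j + 1 → |(T i).slope - R.slope| ≤ 5 / 2 * ε := by
    intro i hi
    have : (T i).slope = (i + 1 / 2) * η := by simp only [T, hη, div_eq_mul_inv]
    rw [this, abs_le]
    rcases hi with rfl | rfl
    · constructor <;> linarith
    · push_cast
      constructor <;> linarith
  have hvolT : ∀ i, volume (T i).carrier ≤ 16 * volume R.carrier := fun i => by
    rw [Rect.volume_carrier, Rect.volume_carrier,
      show (16 : ENNReal) = ENNReal.ofReal 16 by simp, ← ENNReal.ofReal_mul (by norm_num)]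
    refine ENNReal.ofReal_le_ofReal ?_
    calc 4 * R.wid * 2 ^ k * (4 * R.wid) = 16 * (R.wid * 2 ^ k * R.wid) := by ring
      _ ≤ 16 * (R.len * R.wid) := by gcongr
  set f : ℝ × ℝ → ℝ := fun z => u (proj g z)
  have hsplit : ENNReal.ofReal δ * volume R.carrier
      ≤ volume (f ⁻¹' (T j).EX ∩ R.carrier) + volume (f ⁻¹' (T (j + 1)).EX ∩ R.carrier) := by
    rw [Rect.pop, ENNReal.le_div_iff_mul_le (Or.inl R.volume_carrier_ne_zero)
      (Or.inl R.volume_carrier_ne_top)] at hR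
    refine hR.trans (le_trans (measure_mono ?_) (measure_union_le _ _))
    rintro z ⟨hz, hzR⟩
    rcases hcover hz with h | h
    · exact Or.inl ⟨h, hzR⟩
    · exact Or.inr ⟨h, hzR⟩
  have hhalf : ENNReal.ofReal δ * volume R.carrier
      = ENNReal.ofReal (δ / 2) * volume R.carrier + ENNReal.ofReal (δ / 2) * volume R.carrier := by
    rw [← add_mul, ← ENNReal.ofReal_add (by positivity) (by positivity), add_halves]
  have hex : ∃ i : ℤ, (i = j ∨ i = j + 1) ∧
      ENNReal.ofReal (δ / 2) * volume R.carrier ≤ volume (f ⁻¹' (T i).EX ∩ R.carrier) := by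
    by_contra! hcon
    have h1 := hcon j (Or.inl rfl)
    have h2 := hcon (j + 1) (Or.inr rfl)
    rw [hhalf] at hsplit
    exact hsplit.not_gt (ENNReal.add_lt_add h1 h2)
  obtain ⟨i, hi, hpop⟩ := hex
  have hsub : R.carrier ⊆ (T i).carrier :=
    Rect.carrier_subset_carrier rfl hlen1 rfl (hslope i hi)
  refine ⟨T i, rfl, ⟨k, i, hTEX i⟩, ?_, hsub, hvolT i⟩
  rw [Rect.pop, ENNReal.le_div_iff_mul_le (Or.inl (T i).volume_carrier_ne_zero)
      (Or.inl (T i).volume_carrier_ne_top)]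
  calc ENNReal.ofReal (δ / 32) * volume (T i).carrier
      ≤ ENNReal.ofReal (δ / 32) * (16 * volume R.carrier) := by gcongr; exact hvolT i
    _ = ENNReal.ofReal (δ / 2) * volume R.carrier := by
        rw [← mul_assoc, show (16 : ENNReal) = ENNReal.ofReal 16 by simp,
          ← ENNReal.ofReal_mul (by positivity)]
        congr 2
        ring
    _ ≤ volume (f ⁻¹' (T i).EX ∩ R.carrier) := hpop
    _ ≤ _ := measure_mono (inter_subset_inter_right _ hsub)

/-- Weak type bound for the union of the rectangles on which a function has a large average. -/
theorem volume_biUnion_carrier_le {a₀ : ℝ} {g : ℝ → ℝ → ℝ} {u : ℝ → ℝ} {ω δ l : ℝ} (ha : 0 < a₀)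
    (hg : IsDistortion a₀ (1 / 100) g) (hu : Measurable u) (hu' : ∀ᵐ x : ℝ, |u x| ≤ 1 / 10)
    (hδ : 0 < δ) (hl : 0 < l) (m : ℕ) {h : ℝ × ℝ → ENNReal} (hh : Measurable h) {G : Set Rect}
    (hwid : ∀ R ∈ G, R.wid = ω) (hdy : ∀ R ∈ G, R.IsDyadic)
    (hpop : ∀ R ∈ G, ENNReal.ofReal δ ≤ R.pop u g)
    (hav : ∀ R ∈ G, ENNReal.ofReal l * volume R.carrier ≤ ∫⁻ z in R.carrier, h z) :
    volume (⋃ R ∈ G, R.carrier)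
      ≤ 25 * (ENNReal.ofReal (coverConst a₀ m / (δ * l ^ (1 + 1 / (m + 1 : ℝ))))
        * ∫⁻ z, h z ^ (1 + 1 / (m + 1 : ℝ))) := by
  classical
  have hopen : IsOpen (⋃ R ∈ G, R.carrier) := isOpen_biUnion fun R _ => R.isOpen_carrier
  -- Compact subsets reduce the union to finitely many rectangles, where greedy selection is
  -- available.
  rw [hopen.measure_eq_iSup_isCompact]
  refine iSup₂_le fun K hKU => iSup_le fun hK => ?_
  obtain ⟨b, hbG, hbfin, hKb⟩ := hK.elim_finite_subcover_image
    (fun R _ => R.isOpen_carrier) hKU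
  set s := hbfin.toFinset
  have hsG : ∀ R ∈ s, R ∈ G := fun R hR => hbG (hbfin.mem_toFinset.1 hR)
  obtain ⟨t, hts, hcov, hsep⟩ := exists_rect_selection (fun R hR => hwid R (hsG R hR))
    Rect.carrier fun R => ⟨R.center, R.center_mem⟩
  have htG : ∀ R ∈ t, R ∈ G := fun R hR => hsG R (hts hR)
  have had : Admissible u g ω δ t :=
    { wid := fun R hR => hwid R (htG R hR)
      grid := fun R hR R' hR' => (hdy R (htG R hR)).nested (hdy R' (htG R' hR'))
      disjoint := hsep
      pop := fun R hR => hpop R (htG R hR) }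
  have hKt : K ⊆ ⋃ R ∈ t, R.dilate 5 := by
    intro z hz
    obtain ⟨R, hRb, hzR⟩ := mem_iUnion₂.1 (hKb hz)
    have hRs : R ∈ s := hbfin.mem_toFinset.2 hRb
    obtain ⟨R', hR', hEX, hmeet⟩ := hcov R hRs
    exact mem_iUnion₂.2 ⟨R', hR', Rect.carrier_subset_dilate
      ((hwid R (hsG R hRs)).trans (hwid R' (htG R' hR')).symm) hEX hmeet hzR⟩
  calc volume K ≤ ∑ R ∈ t, volume (R.dilate 5) :=
        (measure_mono hKt).trans (measure_biUnion_finset_le _ _)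
    _ = 25 * ∑ R ∈ t, volume R.carrier := by
        rw [Finset.mul_sum]
        refine Finset.sum_congr rfl fun R _ => ?_
        rw [R.volume_dilate (by norm_num), R.volume_carrier, ENNReal.ofReal_mul (by norm_num)]
        norm_num
    _ ≤ _ := by
        gcongr
        exact had.sum_volume_le ha hg hu hu' hδ m hh hl fun R hR => hav R (htG R hR)

/-! ### Weak type bound for the maximal function. -/

theorem isOpen_lt_kakeyaMax {u : ℝ → ℝ} {g : ℝ → ℝ → ℝ} {δ ω : ℝ} {f : ℝ × ℝ → ℝ} (c : ENNReal) :
    IsOpen {z | c < kakeyaMax u g δ ω f z} := by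
  have : {z | c < kakeyaMax u g δ ω f z}
      = ⋃ R ∈ {R : Rect | R ∈ popularRects u g δ ω ∧
          c < (∫⁻ x in R.carrier, ‖f x‖ₑ) / volume R.carrier}, R.carrier := by
    ext z
    simp only [kakeyaMax, mem_ofPred_eq, lt_iSup_iff, mem_iUnion, exists_prop]
    constructor
    · rintro ⟨R, ⟨h1, h2⟩, h3⟩
      exact ⟨R, ⟨h1, h3⟩, h2⟩
    · rintro ⟨R, ⟨h1, h3⟩, h2⟩
      exact ⟨R, ⟨h1, h2⟩, h3⟩
  rw [this]
  exact isOpen_biUnion fun R _ => R.isOpen_carrier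

theorem measurable_kakeyaMax {u : ℝ → ℝ} {g : ℝ → ℝ → ℝ} {δ ω : ℝ} {f : ℝ × ℝ → ℝ} :
    Measurable (kakeyaMax u g δ ω f) :=
  measurable_of_Ioi fun c => (isOpen_lt_kakeyaMax c).measurableSet

/-- Values of `|f|` up to `l / 32` contribute at most `l / 2 * |R|` on a dyadic rectangle of area at
most `16 * |R|`, so the large values alone keep an average of `l / 32` there. This truncation is
what interpolation uses. -/
theorem volume_lt_kakeyaMax_le {a₀ : ℝ} {g : ℝ → ℝ → ℝ} {u : ℝ → ℝ} {ω δ l : ℝ} (ha : 0 < a₀)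
    (hg : IsDistortion a₀ (1 / 100) g) (hu : Measurable u) (hu' : ∀ᵐ x : ℝ, |u x| ≤ 1 / 10)
    (hδ : 0 < δ) (hl : 0 < l) (m : ℕ) {f : ℝ × ℝ → ℝ} (hf : Measurable f) :
    volume {z | ENNReal.ofReal l < kakeyaMax u g δ ω f z}
      ≤ 25 * (ENNReal.ofReal (coverConst a₀ m / (δ / 32 * (l / 32) ^ (1 + 1 / (m + 1 : ℝ))))
        * ∫⁻ z in {z | ENNReal.ofReal (l / 32) < ‖f z‖ₑ}, ‖f z‖ₑ ^ (1 + 1 / (m + 1 : ℝ))) := by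
  set S := {z | ENNReal.ofReal (l / 32) < ‖f z‖ₑ}
  have hS : MeasurableSet S := measurableSet_lt measurable_const hf.enorm
  set h := S.indicator fun z => ‖f z‖ₑ
  have hh : Measurable h := hf.enorm.indicator hS
  have hI : ∫⁻ z in S, ‖f z‖ₑ ^ (1 + 1 / (m + 1 : ℝ)) = ∫⁻ z, h z ^ (1 + 1 / (m + 1 : ℝ)) := by
    rw [← lintegral_indicator hS]
    refine lintegral_congr fun z => ?_
    by_cases hz : z ∈ S
    · simp only [h, indicator_of_mem hz]
    · simp only [h, indicator_of_notMem hz]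
      rw [ENNReal.zero_rpow_of_pos (by positivity)]
  rw [hI]
  set G := {R : Rect | R.wid = 4 * ω ∧ R.IsDyadic ∧ ENNReal.ofReal (δ / 32) ≤ R.pop u g ∧
    ENNReal.ofReal (l / 32) * volume R.carrier ≤ ∫⁻ z in R.carrier, h z}
  refine le_trans (measure_mono ?_) (volume_biUnion_carrier_le (ω := 4 * ω) (G := G) ha hg hu hu'
    (by positivity) (by positivity) m hh (fun R hR => hR.1) (fun R hR => hR.2.1)
    (fun R hR => hR.2.2.1) (fun R hR => hR.2.2.2))
  intro z hz
  simp only [kakeyaMax, mem_ofPred_eq, lt_iSup_iff, exists_prop] at hz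
  obtain ⟨R, ⟨⟨-, hRpop, hRw⟩, hzR⟩, hlt⟩ := hz
  obtain ⟨R', hw', hdy', hpop', hsub, hvol⟩ := exists_dyadic_rect hδ hRpop
  refine mem_iUnion₂.2 ⟨R', ⟨hw'.trans (by rw [hRw]), hdy', hpop', ?_⟩, hsub hzR⟩
  have h1 : ENNReal.ofReal l * volume R.carrier ≤ ∫⁻ x in R.carrier, ‖f x‖ₑ :=
    (ENNReal.le_div_iff_mul_le (Or.inl R.volume_carrier_ne_zero)
      (Or.inl R.volume_carrier_ne_top)).1 hlt.le
  have h2 : ∫⁻ x in R'.carrier, ‖f x‖ₑ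
      ≤ (∫⁻ x in R'.carrier, h x) + ENNReal.ofReal (l / 32) * volume R'.carrier := by
    rw [← setLIntegral_const, ← lintegral_add_left hh]
    refine lintegral_mono fun x => ?_
    by_cases hx : x ∈ S
    · simp only [h, indicator_of_mem hx]
      exact le_self_add
    · simp only [h, indicator_of_notMem hx, zero_add]
      exact not_lt.1 hx
  have h3 : ENNReal.ofReal (l / 32) * volume R'.carrier
      + ENNReal.ofReal (l / 32) * volume R'.carrier ≤ ENNReal.ofReal l * volume R.carrier := by
    rw [← add_mul, ← ENNReal.ofReal_add (by positivity) (by positivity)]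
    calc ENNReal.ofReal (l / 32 + l / 32) * volume R'.carrier
        ≤ ENNReal.ofReal (l / 32 + l / 32) * (16 * volume R.carrier) := by gcongr
      _ = _ := by
        rw [← mul_assoc, show (16 : ENNReal) = ENNReal.ofReal 16 by simp,
          ← ENNReal.ofReal_mul (by positivity)]
        congr 2
        ring
  refine (ENNReal.add_le_add_iff_right (ENNReal.mul_ne_top ENNReal.ofReal_ne_top
    R'.volume_carrier_ne_top : ENNReal.ofReal (l / 32) * volume R'.carrier ≠ ⊤)).1 ?_
  exact h3.trans (h1.trans ((lintegral_mono_set hsub).trans h2))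

/-! ### Interpolation and the strong type bound. -/

theorem tsum_zpow_lt_le {α y : ℝ} (hα : 0 < α) (hy : 0 ≤ y) :
    ∑' k : ℤ, {x : ℝ | (2 : ℝ) ^ k < x}.indicator
      (fun _ => ENNReal.ofReal (((2 : ℝ) ^ k) ^ α)) y
        ≤ ENNReal.ofReal (y ^ α / (1 - 2 ^ (-α))) := by
  have h2α : (2 : ℝ) ^ (-α) < 1 := Real.rpow_lt_one_of_one_lt_of_neg one_lt_two (neg_lt_zero.2 hα)
  have h2α0 : (0 : ℝ) < 2 ^ (-α) := by positivity
  rcases hy.eq_or_lt with rfl | hy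
  · rw [ENNReal.tsum_eq_zero.2 fun k => ?_]
    · exact zero_le
    · exact indicator_of_notMem (fun h : (2 : ℝ) ^ k < 0 => h.not_ge (by positivity)) _
  obtain ⟨n, hn1, hn2⟩ := exists_mem_Ioc_zpow hy one_lt_two
  have hinj : Function.Injective fun i : ℕ => n - (i : ℤ) := fun i j h => by
    simpa using h
  rw [← hinj.tsum_eq]
  · have hterm : ∀ i : ℕ,
        ((2 : ℝ) ^ (n - (i : ℤ))) ^ α = (2 ^ n) ^ α * (2 ^ (-α)) ^ i := fun i => by
      rw [zpow_sub₀ two_ne_zero, Real.div_rpow (by positivity) (by positivity), zpow_natCast,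
        ← Real.rpow_natCast, ← Real.rpow_natCast, ← Real.rpow_mul zero_le_two,
        ← Real.rpow_mul zero_le_two, div_eq_mul_inv, ← Real.rpow_neg zero_le_two]
      congr 2
      ring
    have hsum : Summable fun i : ℕ => ((2 : ℝ) ^ n) ^ α * ((2 : ℝ) ^ (-α)) ^ i :=
      (summable_geometric_of_lt_one h2α0.le h2α).mul_left _
    calc ∑' i : ℕ, {x : ℝ | (2 : ℝ) ^ (n - (i : ℤ)) < x}.indicator
          (fun _ => ENNReal.ofReal (((2 : ℝ) ^ (n - (i : ℤ))) ^ α)) y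
        ≤ ∑' i : ℕ, ENNReal.ofReal ((2 ^ n) ^ α * (2 ^ (-α)) ^ i) := by
          refine ENNReal.tsum_le_tsum fun i => ?_
          rw [← hterm]
          exact indicator_le_self' (fun _ _ => zero_le) _
      _ = ENNReal.ofReal ((2 ^ n) ^ α / (1 - 2 ^ (-α))) := by
          rw [← ENNReal.ofReal_tsum_of_nonneg (fun i => by positivity) hsum, tsum_mul_left,
            tsum_geometric_of_lt_one h2α0.le h2α, div_eq_mul_inv]
      _ ≤ _ := by
          have : 0 < 1 - (2 : ℝ) ^ (-α) := sub_pos.2 h2α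
          gcongr
  · intro k hk
    have hk' : (2 : ℝ) ^ k < y := by
      by_contra hcon
      exact hk (indicator_of_notMem (fun h : (2 : ℝ) ^ k < y => hcon h) _)
    have hkn : k < n + 1 := (zpow_lt_zpow_iff_right₀ one_lt_two).1 (hk'.trans_le hn2)
    exact ⟨(n - k).toNat, by simp only; omega⟩

theorem rpow_le_tsum_zpow {p : ℝ} (hp : 1 ≤ p) (x : ENNReal) :
    x ^ p ≤ ∑' k : ℤ, {y : ENNReal | ENNReal.ofReal ((2 : ℝ) ^ k) < y}.indicator
      (fun _ => ENNReal.ofReal (((2 : ℝ) ^ (k + 1)) ^ p)) x := by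
  have hp0 : 0 < p := by linarith
  have hterm : ∀ k : ℤ, ENNReal.ofReal ((2 : ℝ) ^ k) < x → ENNReal.ofReal (((2 : ℝ) ^ (k + 1)) ^ p)
      ≤ ∑' k : ℤ, {y : ENNReal | ENNReal.ofReal ((2 : ℝ) ^ k) < y}.indicator
      (fun _ => ENNReal.ofReal (((2 : ℝ) ^ (k + 1)) ^ p)) x := fun k hk => by
    refine le_trans (le_of_eq ?_) (ENNReal.le_tsum k)
    have hmem : x ∈ {y : ENNReal | ENNReal.ofReal ((2 : ℝ) ^ k) < y} := hk
    rw [indicator_of_mem hmem]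
  rcases eq_or_ne x ⊤ with rfl | hx
  · rw [ENNReal.top_rpow_of_pos hp0]
    refine (ENNReal.eq_top_of_forall_nnreal_le fun r => ?_).ge
    obtain ⟨n, hn⟩ := exists_nat_gt (r : ℝ)
    refine le_trans ?_ (hterm n ENNReal.ofReal_lt_top)
    rw [← ENNReal.ofReal_coe_nnreal]
    refine ENNReal.ofReal_le_ofReal ?_
    have h1 : (1 : ℝ) ≤ 2 ^ ((n : ℤ) + 1) := by
      have h3 : (1 : ℝ) ≤ 2 ^ (n + 1) := one_le_pow₀ one_le_two
      exact_mod_cast h3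
    have h2 : (n : ℝ) ≤ 2 ^ ((n : ℤ) + 1) := by
      have h3 : (n : ℝ) < 2 ^ n := by exact_mod_cast Nat.lt_two_pow_self
      have h4 : (2 : ℝ) ^ n ≤ 2 ^ (n + 1) := pow_le_pow_right₀ one_le_two (Nat.le_succ n)
      exact_mod_cast h3.le.trans h4
    calc (r : ℝ) ≤ 2 ^ ((n : ℤ) + 1) := hn.le.trans h2
      _ ≤ _ := Real.self_le_rpow_of_one_le h1 hp
  rcases eq_or_ne x 0 with rfl | hx0
  · rw [ENNReal.zero_rpow_of_pos hp0]
    exact zero_le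
  have hxpos := ENNReal.toReal_pos hx0 hx
  obtain ⟨n, hn1, hn2⟩ := exists_mem_Ioc_zpow hxpos one_lt_two
  refine le_trans ?_ (hterm n ((ENNReal.ofReal_lt_iff_lt_toReal (by positivity) hx).2 hn1))
  rw [← ENNReal.ofReal_toReal hx, ENNReal.ofReal_rpow_of_pos hxpos]
  gcongr

/-- Interpolation of a truncated weak type bound at `q` with the trivial bound at infinity. -/
theorem lintegral_rpow_le_of_weak_type {X : Type*} [MeasurableSpace X] {μ : Measure X}
    {M : X → ENNReal} (hM : Measurable M) {f : X → ℝ} (hf : Measurable f) {κ D q p : ℝ}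
    (hκ : 0 < κ) (hD : 0 ≤ D) (hqp : q < p) (hp : 1 ≤ p)
    (hweak : ∀ t, 0 < t → μ {z | ENNReal.ofReal t < M z} ≤ ENNReal.ofReal (D / t ^ q)
      * ∫⁻ z in {z | ENNReal.ofReal (t / κ) < ‖f z‖ₑ}, ‖f z‖ₑ ^ q ∂μ) :
    ∫⁻ z, M z ^ p ∂μ ≤ ENNReal.ofReal (D * 2 ^ p * (κ ^ (p - q) / (1 - 2 ^ (-(p - q)))))
      * ∫⁻ z, ‖f z‖ₑ ^ p ∂μ := by
  have hα : 0 < p - q := sub_pos.2 hqp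
  set α := p - q
  have h2α : 0 < 1 - (2 : ℝ) ^ (-α) :=
    sub_pos.2 (Real.rpow_lt_one_of_one_lt_of_neg one_lt_two (neg_lt_zero.2 hα))
  have hSm : ∀ k : ℤ, MeasurableSet {z | ENNReal.ofReal ((2 : ℝ) ^ k) < M z} :=
    fun k => measurableSet_lt measurable_const hM
  have hTm : ∀ k : ℤ, MeasurableSet {z | ENNReal.ofReal ((2 : ℝ) ^ k / κ) < ‖f z‖ₑ} :=
    fun k => measurableSet_lt measurable_const hf.enorm
  have hcoef : ∀ k : ℤ, ((2 : ℝ) ^ (k + 1)) ^ p * (D / ((2 : ℝ) ^ k) ^ q)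
      = D * 2 ^ p * ((2 : ℝ) ^ k) ^ α := fun k => by
    rw [zpow_add_one₀ two_ne_zero, Real.mul_rpow (by positivity) zero_le_two,
      Real.rpow_sub (by positivity)]
    ring
  -- In a dyadic layer cake, level `2 ^ k` sees only points with `2 ^ k < κ * |f z|`; exchanging sum
  -- and integral leaves a geometric series in `(2 ^ k) ^ (p - q)`.
  calc ∫⁻ z, M z ^ p ∂μ
      ≤ ∫⁻ z, ∑' k : ℤ, {z | ENNReal.ofReal ((2 : ℝ) ^ k) < M z}.indicator
          (fun _ => ENNReal.ofReal (((2 : ℝ) ^ (k + 1)) ^ p)) z ∂μ :=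
        lintegral_mono fun z => rpow_le_tsum_zpow hp (M z)
    _ = ∑' k : ℤ, ENNReal.ofReal (((2 : ℝ) ^ (k + 1)) ^ p)
          * μ {z | ENNReal.ofReal ((2 : ℝ) ^ k) < M z} := by
        rw [lintegral_tsum fun k => (measurable_const.indicator (hSm k)).aemeasurable]
        exact tsum_congr fun k => lintegral_indicator_const (hSm k) _
    _ ≤ ∑' k : ℤ, ∫⁻ z, {z | ENNReal.ofReal ((2 : ℝ) ^ k / κ) < ‖f z‖ₑ}.indicator
          (fun z => ENNReal.ofReal (D * 2 ^ p * ((2 : ℝ) ^ k) ^ α) * ‖f z‖ₑ ^ q) z ∂μ := by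
        refine ENNReal.tsum_le_tsum fun k => ?_
        rw [lintegral_indicator (hTm k), lintegral_const_mul _ (hf.enorm.pow_const _), ← hcoef,
          ENNReal.ofReal_mul (by positivity), mul_assoc]
        gcongr
        exact hweak _ (by positivity)
    _ = ∫⁻ z, ∑' k : ℤ, {z | ENNReal.ofReal ((2 : ℝ) ^ k / κ) < ‖f z‖ₑ}.indicator
          (fun z => ENNReal.ofReal (D * 2 ^ p * ((2 : ℝ) ^ k) ^ α) * ‖f z‖ₑ ^ q) z ∂μ := by
        rw [lintegral_tsum fun k =>
          (((hf.enorm.pow_const _).const_mul _).indicator (hTm k)).aemeasurable]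
    _ ≤ ∫⁻ z, ENNReal.ofReal (D * 2 ^ p * (κ ^ α / (1 - 2 ^ (-α)))) * ‖f z‖ₑ ^ p ∂μ := by
        refine lintegral_mono fun z => ?_
        have hy : 0 ≤ κ * |f z| := by positivity
        rcases eq_or_ne (f z) 0 with h0 | h0
        · refine le_trans (le_of_eq (ENNReal.tsum_eq_zero.2 fun k => ?_)) zero_le
          refine indicator_of_notMem (fun h => ?_) _
          change _ < ‖f z‖ₑ at h
          rw [h0, enorm_zero] at h
          exact not_lt_zero h
        have hfz : 0 < |f z| := abs_pos.2 h0
        calc ∑' k : ℤ, {z | ENNReal.ofReal ((2 : ℝ) ^ k / κ) < ‖f z‖ₑ}.indicator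
              (fun z => ENNReal.ofReal (D * 2 ^ p * ((2 : ℝ) ^ k) ^ α) * ‖f z‖ₑ ^ q) z
            = ∑' k : ℤ, ENNReal.ofReal (D * 2 ^ p) * ‖f z‖ₑ ^ q *
              {x : ℝ | (2 : ℝ) ^ k < x}.indicator
                (fun _ => ENNReal.ofReal (((2 : ℝ) ^ k) ^ α)) (κ * |f z|) := by
              refine tsum_congr fun k => ?_
              have hiff : z ∈ {z | ENNReal.ofReal ((2 : ℝ) ^ k / κ) < ‖f z‖ₑ} ↔
                  κ * |f z| ∈ {x : ℝ | (2 : ℝ) ^ k < x} := by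
                change ENNReal.ofReal ((2 : ℝ) ^ k / κ) < ‖f z‖ₑ ↔ (2 : ℝ) ^ k < κ * |f z|
                rw [Real.enorm_eq_ofReal_abs, ENNReal.ofReal_lt_ofReal_iff hfz, div_lt_iff₀' hκ]
              by_cases hz : z ∈ {z | ENNReal.ofReal ((2 : ℝ) ^ k / κ) < ‖f z‖ₑ}
              · rw [indicator_of_mem hz, indicator_of_mem (hiff.1 hz),
                  ENNReal.ofReal_mul (by positivity)]
                ring
              · rw [indicator_of_notMem hz, indicator_of_notMem fun h => hz (hiff.2 h), mul_zero]
          _ ≤ ENNReal.ofReal (D * 2 ^ p) * ‖f z‖ₑ ^ q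
              * ENNReal.ofReal ((κ * |f z|) ^ α / (1 - 2 ^ (-α))) := by
              rw [ENNReal.tsum_mul_left]
              gcongr
              exact tsum_zpow_lt_le hα hy
          _ = _ := by
              rw [Real.enorm_eq_ofReal_abs, ENNReal.ofReal_rpow_of_pos hfz,
                ENNReal.ofReal_rpow_of_pos hfz, ← ENNReal.ofReal_mul (by positivity),
                ← ENNReal.ofReal_mul (by positivity), ← ENNReal.ofReal_mul (by positivity),
                Real.mul_rpow hκ.le hfz.le, show p = q + α by simp [α], Real.rpow_add hfz]
              congr 1
              ring
    _ = _ := lintegral_const_mul _ (hf.enorm.pow_const _)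

theorem kakeyaMax_congr {u : ℝ → ℝ} {g : ℝ → ℝ → ℝ} {δ ω : ℝ} {f f' : ℝ × ℝ → ℝ}
    (h : f =ᵐ[volume] f') : kakeyaMax u g δ ω f = kakeyaMax u g δ ω f' := by
  funext z
  simp only [kakeyaMax]
  refine iSup_congr fun R => iSup_congr fun _ => ?_
  congr 1
  refine lintegral_congr_ae (ae_restrict_of_ae ?_)
  filter_upwards [h] with x hx
  rw [hx]

theorem Rect.pop_le_one (u : ℝ → ℝ) (g : ℝ → ℝ → ℝ) (R : Rect) : R.pop u g ≤ 1 :=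
  ENNReal.div_le_of_le_mul (by rw [one_mul]; exact measure_mono inter_subset_right)

/-- The constant of the interpolated maximal inequality. -/
def maxConst (a₀ p : ℝ) (m : ℕ) : ℝ :=
  25 * coverConst a₀ m * 32 * 32 ^ (1 + 1 / (m + 1 : ℝ)) * 2 ^ p
    * (32 ^ (p - (1 + 1 / (m + 1 : ℝ))) / (1 - 2 ^ (-(p - (1 + 1 / (m + 1 : ℝ))))))

theorem maxConst_pos {a₀ p : ℝ} (ha : 0 < a₀) {m : ℕ} (hm : 1 + 1 / (m + 1 : ℝ) < p) :
    0 < maxConst a₀ p m := by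
  have h2 : 0 < 1 - (2 : ℝ) ^ (-(p - (1 + 1 / (m + 1 : ℝ)))) :=
    sub_pos.2 (Real.rpow_lt_one_of_one_lt_of_neg one_lt_two (by linarith))
  have := coverConst_pos ha m
  rw [maxConst]
  positivity

theorem lintegral_kakeyaMax_rpow_le {a₀ : ℝ} {g : ℝ → ℝ → ℝ} {u : ℝ → ℝ} {ω δ p : ℝ} (ha : 0 < a₀)
    (hg : IsDistortion a₀ (1 / 100) g) (hu : Measurable u) (hu' : ∀ᵐ x : ℝ, |u x| ≤ 1 / 10)
    (hδ : 0 < δ) {m : ℕ} (hm : 1 + 1 / (m + 1 : ℝ) < p) {f : ℝ × ℝ → ℝ} (hf : Measurable f) :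
    ∫⁻ z, kakeyaMax u g δ ω f z ^ p
      ≤ ENNReal.ofReal (maxConst a₀ p m / δ) * ∫⁻ z, ‖f z‖ₑ ^ p := by
  have hc := coverConst_pos ha m
  have hp : 1 ≤ p := by
    have : 0 < 1 / (m + 1 : ℝ) := by positivity
    linarith
  have := lintegral_rpow_le_of_weak_type (μ := volume) (measurable_kakeyaMax (u := u) (g := g)
    (δ := δ) (ω := ω) (f := f)) hf (κ := 32)
    (D := 25 * coverConst a₀ m * 32 * 32 ^ (1 + 1 / (m + 1 : ℝ)) / δ) (by norm_num)
    (by positivity) hm hp fun t ht => by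
      refine (volume_lt_kakeyaMax_le ha hg hu hu' hδ ht m hf).trans (le_of_eq ?_)
      rw [← mul_assoc, show (25 : ENNReal) = ENNReal.ofReal 25 by simp,
        ← ENNReal.ofReal_mul (by norm_num)]
      congr 2
      rw [Real.div_rpow ht.le (by norm_num)]
      field_simp
  refine this.trans (le_of_eq ?_)
  congr 2
  rw [maxConst]
  ring

/-- The `p`-th root produces `δ ^ (-1 / p)`, at most `1 / δ` when `δ ≤ 1`. A single popular
rectangle forces `δ ≤ 1`; without one the maximal function vanishes. -/
theorem eLpNorm_kakeyaMax_le {a₀ : ℝ} {g : ℝ → ℝ → ℝ} {u : ℝ → ℝ} {ω δ p : ℝ} (ha : 0 < a₀)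
    (hg : IsDistortion a₀ (1 / 100) g) (hu : Measurable u) (hu' : ∀ᵐ x : ℝ, |u x| ≤ 1 / 10)
    (hδ : 0 < δ) {m : ℕ} (hm : 1 + 1 / (m + 1 : ℝ) < p) {f : ℝ × ℝ → ℝ}
    (hf : AEStronglyMeasurable f) :
    eLpNorm (kakeyaMax u g δ ω f) (ENNReal.ofReal p) volume
      ≤ ENNReal.ofReal (maxConst a₀ p m ^ (1 / p) / δ) * eLpNorm f (ENNReal.ofReal p) volume := by
  have hp : 1 ≤ p := by
    have : 0 < 1 / (m + 1 : ℝ) := by positivity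
    linarith
  have hp0 : 0 < p := by linarith
  have hc := maxConst_pos ha hm
  rw [kakeyaMax_congr hf.ae_eq_mk, eLpNorm_congr_ae hf.ae_eq_mk]
  have hf' : Measurable (hf.mk f) := hf.stronglyMeasurable_mk.measurable
  set f' := hf.mk f
  rcases (popularRects u g δ ω).eq_empty_or_nonempty with hemp | ⟨R, -, hR, -⟩
  · have : kakeyaMax u g δ ω f' = 0 := by
      funext z
      simp [kakeyaMax, hemp]
    rw [this, eLpNorm_zero]
    exact zero_le
  have hδ1 : δ ≤ 1 := by simpa using hR.trans (R.pop_le_one u g)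
  have hp0' : ENNReal.ofReal p ≠ 0 := (ENNReal.ofReal_pos.2 hp0).ne'
  rw [eLpNorm_eq_lintegral_rpow_enorm_toReal hp0' ENNReal.ofReal_ne_top,
    eLpNorm_eq_lintegral_rpow_enorm_toReal hp0' ENNReal.ofReal_ne_top,
    ENNReal.toReal_ofReal hp0.le]
  simp only [enorm_eq_self]
  calc (∫⁻ z, kakeyaMax u g δ ω f' z ^ p) ^ (1 / p)
      ≤ (ENNReal.ofReal (maxConst a₀ p m / δ) * ∫⁻ z, ‖f' z‖ₑ ^ p) ^ (1 / p) := by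
        gcongr
        exact lintegral_kakeyaMax_rpow_le ha hg hu hu' hδ hm hf'
    _ = ENNReal.ofReal (maxConst a₀ p m ^ (1 / p) / δ ^ (1 / p))
        * (∫⁻ z, ‖f' z‖ₑ ^ p) ^ (1 / p) := by
        rw [ENNReal.mul_rpow_of_nonneg _ _ (by positivity),
          ENNReal.ofReal_rpow_of_pos (by positivity), Real.div_rpow hc.le hδ.le]
    _ ≤ _ := by
        gcongr
        calc δ = δ ^ (1 : ℝ) := (Real.rpow_one δ).symm
          _ ≤ δ ^ (1 / p) :=
            Real.rpow_le_rpow_of_exponent_ge hδ hδ1 ((div_le_one hp0).2 hp)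

end LipKakeya

end

theorem mainTheorem5 :
    ∃ C₀ : ℝ, 1 ≤ C₀ ∧ ∀ a₀ p : ℝ, 0 < a₀ → 1 < p → ∃ A : ℝ, 0 < A ∧
      ∀ (g : ℝ → ℝ → ℝ) (u : ℝ → ℝ), LipKakeya.IsDistortion a₀ (1 / 100) g →
        Measurable u → (∀ᵐ x : ℝ, |u x| ≤ 1 / 10) →
        -- the covering lemma
        (∀ C : ℝ, C₀ ≤ C → ∀ ω δ l : ℝ, 0 < ω → 0 < δ → 0 < l →
          ∀ F : Set (ℝ × ℝ), MeasurableSet F → ∀ R₀ : Set LipKakeya.Rect,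
          (∀ R ∈ R₀, R.wid = ω) →
          (∀ R ∈ R₀, ∀ R' ∈ R₀, R.EX ⊆ R'.EX ∨ R'.EX ⊆ R.EX ∨
            Disjoint (interior R.EX) (interior R'.EX)) →
          (R₀.Pairwise fun R R' => ¬ LipKakeya.Rect.Below C R R') →
          (∀ R ∈ R₀, ENNReal.ofReal δ ≤ R.pop u g) →
          (∀ R ∈ R₀, ENNReal.ofReal l ≤ volume (F ∩ R.carrier) / volume R.carrier) →
          ∑' R : R₀, volume R.1.carrier
            ≤ ENNReal.ofReal A * volume F / ENNReal.ofReal (δ * l ^ p)) ∧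
        -- the bound for the maximal operator
        (∀ ω δ : ℝ, 0 < ω → 0 < δ → ∀ f : ℝ × ℝ → ℝ, MemLp f (ENNReal.ofReal p) volume →
          eLpNorm (LipKakeya.kakeyaMax u g δ ω f) (ENNReal.ofReal p) volume
            ≤ ENNReal.ofReal (A / δ) * eLpNorm f (ENNReal.ofReal p) volume) := by
  -- The dilation factor of `Rect.carrier_subset_dilate`.
  refine ⟨5, by norm_num, fun a₀ p ha hp => ?_⟩
  obtain ⟨m, hm⟩ := LipKakeya.exists_one_add_inv_lt hp
  have hc := LipKakeya.coverConst_pos ha m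
  have hc' : 0 < LipKakeya.maxConst a₀ p m ^ (1 / p) :=
    Real.rpow_pos_of_pos (LipKakeya.maxConst_pos ha hm) _
  refine ⟨LipKakeya.coverConst a₀ m + LipKakeya.maxConst a₀ p m ^ (1 / p), by positivity,
    fun g u hg hu hu' => ⟨?_, ?_⟩⟩
  · intro C hC ω δ l _ hδ hl F hF R₀ hwid hgrid hinc hpop hav
    refine (LipKakeya.tsum_volume_le ha hg hu hu' hC hδ hl hm.le hF hwid hgrid hinc hpop hav).trans
      ?_
    gcongr
    linarith
  · intro ω δ _ hδ f hf
    refine (LipKakeya.eLpNorm_kakeyaMax_le ha hg hu hu' hδ hm hf.1).trans ?_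
    gcongr
    linarith
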